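/- Let $\Omega\subset\mathbb{R}^2$ be an open, simply connected set containing the origin $O$, and write $\Omega-O=\Omega\setminus\{O\}$. Let $\boldsymbol{E}=(E_{ij})\in\mathcal{A}(\Omega,\operatorname{Sym})$, that is, $\boldsymbol{E}$ is a distribution on $\Omega$ with values in the symmetric $2\times 2$ matrices whose restriction to $\Omega-O$ is (given by) a smooth function, denoted $\boldsymbol{E}|_{\Omega-O}$. Let $N=\sum_{\alpha}N^{\alpha}\partial^{\alpha}\delta_O$ be a finite sum with $N^{\alpha}\in\mathbb{R}$, $\alpha\in\mathbb{N}^2$. Conventions. For a vector field or vector valued distribution, $\operatorname{curl}\boldsymbol{v}=\operatorname{Curl}\boldsymbol{v}=\partial_1v_2-\partial_2v_1$ (classical, respectively distributional, derivatives); for a tensor field the curl is taken row by row, $(\operatorname{curl}\boldsymbol{V})_i=\partial_1V_{i2}-\partial_2V_{i1}$, and likewise $\operatorname{Curl}$. For $\boldsymbol{v}\in\mathbb{R}^2$ let $\boldsymbol{e}_3\times\boldsymbol{v}=-v_2\boldsymbol{e}_1+v_1\boldsymbol{e}_2=-\boldsymbol{v}\times\boldsymbol{e}_3$, and for a planar vector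 $\boldsymbol{w}=\operatorname{curl}\boldsymbol{V}$ let $\boldsymbol{v}\times\boldsymbol{w}$ stand for $\boldsymbol{v}\times(\boldsymbol{e}_3\otimes\boldsymbol{w})=(\boldsymbol{v}\times\boldsymbol{e}_3)\otimes\boldsymbol{w}$. The scaling degree $\operatorname{sd}(T)\in[-\infty,\infty]$ of a scalar or tensor valued distribution $T$ on $\Omega$ is the infimum of all $k\in\mathbb{R}$ such that, for a ball $B_r\subset\Omega$ about $O$, $\lambda^kT(\phi_\lambda)\to0$ as $\lambda\to0^+$ for every test function $\phi$ on $B_r$ (componentwise for tensors), where $\phi_\lambda(\boldsymbol{x})=\lambda^{-2}\phi(\boldsymbol{x}/\lambda)$; the degree of divergence is $\operatorname{deg}(T)=\operatorname{sd}(T)-2$. Let $\epsilon>0$ be such that the closed disc of radius $\epsilon$ about $O$ lies in $\Omega$, and let $\partial B_\epsilon$ be its boundary circle, oriented counterclockwise. (a) If $\operatorname{Curl}\operatorname{Curl}\boldsymbol{E}=N$, then (i) $\operatorname{curl}\operatorname{curl}(\boldsymbol{E}|_{\Omega-O})=0$ in $\Omega-O$; (ii) for all $\boldsymbol{x}\in\Omega-O$,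 $$\int_{\partial B_\epsilon}\{(\boldsymbol{E}|_{\Omega-O})(\boldsymbol{y})+(\boldsymbol{y}-\boldsymbol{x})\times\operatorname{curl}(\boldsymbol{E}|_{\Omega-O})(\boldsymbol{y})\}\,d\boldsymbol{y}=-N^{(0,1)}\boldsymbol{e}_1+N^{(1,0)}\boldsymbol{e}_2+N^{(0,0)}\,\boldsymbol{e}_3\times\boldsymbol{x};$$ (iii) $\operatorname{deg}(N)\le\operatorname{deg}(\boldsymbol{E})+2$. (b) If $\operatorname{deg}(\boldsymbol{E})<0$, then $\operatorname{Curl}\operatorname{Curl}\boldsymbol{E}=N$ holds if and only if (i), (ii) and (iii) hold. -/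

import Mathlib

open TopologicalSpace Set
open scoped Distributions LineDeriv ContDiff Topology

noncomputable section

namespace PlanarIncompatibility

/-- The Euclidean plane `ℝ²`; the distinguished point `O` is the origin `0`. -/
abbrev Plane : Type := EuclideanSpace ℝ (Fin 2)

/-- The standard orthonormal basis: `e 0` is the first and `e 1` the second basis vector. -/
def e (i : Fin 2) : Plane := EuclideanSpace.single i 1

/-- The in-plane vector `v × e₃ = v₂ e₁ - v₁ e₂`. -/
def crossE3 (v : Plane) : Plane := !₂[v 1, - v 0]

/-- The in-plane vector `e₃ × v = - v₂ e₁ + v₁ e₂`. -/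
def e3Cross (v : Plane) : Plane := !₂[- v 1, v 0]

/-! ### Restriction of distributions -/

/-- The restriction `T|_U` of a distribution `T` on `Ω` to an open set `U ⊆ Ω`:
`T|_U ψ = T ψ̄`, with `ψ̄` the extension of `ψ` by zero. -/
def restrictTo {Ω : Opens Plane} (U : Opens Plane) (T : 𝓓'(Ω, ℝ)) : 𝓓'(U, ℝ) :=
  (TestFunction.monoCLM ℝ : 𝓓(U, ℝ) →L[ℝ] 𝓓(Ω, ℝ)).precompCompactConvergenceCLM ℝ T

theorem restrictTo_apply {Ω U : Opens Plane} (T : 𝓓'(Ω, ℝ)) (ψ : 𝓓(U, ℝ)) :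
    restrictTo U T ψ = T (TestFunction.monoCLM ℝ ψ) := rfl

/-- The punctured domain `Ω - O`. -/
def puncture (Ω : Opens Plane) : Opens Plane :=
  ⟨(Ω : Set Plane) \ {0}, Ω.isOpen.sdiff isClosed_singleton⟩

/-- `f` is smooth on the open set `U`, and `T` is the distribution `ψ ↦ ∫_U f ψ dx` on `U`. -/
def IsSmoothDensity {U : Opens Plane} (T : 𝓓'(U, ℝ)) (f : Plane → ℝ) : Prop :=
  ContDiffOn ℝ ∞ f (U : Set Plane) ∧
    ∀ ψ : 𝓓(U, ℝ), T ψ = ∫ x in (U : Set Plane), f x * ψ x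

/-- The space `𝒜(Ω)` of distributions on `Ω` that are smooth away from `O`:
`T|_{Ω - O}` is given by a smooth function. -/
def IsSingularField {Ω : Opens Plane} (T : 𝓓'(Ω, ℝ)) : Prop :=
  ∃ f : Plane → ℝ, IsSmoothDensity (restrictTo (puncture Ω) T) f

/-! ### Scaling degree and degree of divergence -/

/-- The open ball `B_r` about `O`. -/
def ballO (r : ℝ) : Opens Plane := ⟨Metric.ball 0 r, Metric.isOpen_ball⟩

/-- The rescaled test function `φ_l (x) = l⁻² φ (x / l)` on `B_r`, for `0 < l ≤ 1`
(and `0` for the other values of `l`, which play no role). -/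
def rescale {r : ℝ} (l : ℝ) (φ : 𝓓(ballO r, ℝ)) : 𝓓(ballO r, ℝ) := by
  classical
  exact
  if h : 0 < l ∧ l ≤ 1 then
    { toFun := fun x => (l ^ 2)⁻¹ * φ (l⁻¹ • x)
      contDiff' := contDiff_const.mul (φ.contDiff.comp (contDiff_const_smul _))
      hasCompactSupport' :=
        (φ.hasCompactSupport.comp_smul (inv_ne_zero h.1.ne')).mul_left
      tsupport_subset' := by
        have h1 : tsupport (fun x => (l ^ 2)⁻¹ * φ (l⁻¹ • x))
            ⊆ (fun x : Plane => l⁻¹ • x) ⁻¹' tsupport φ := by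
          refine closure_minimal ?_ ((isClosed_tsupport φ).preimage (continuous_const_smul _))
          intro x hx
          exact subset_tsupport φ (right_ne_zero_of_mul hx)
        intro x hx
        have h2 : l⁻¹ • x ∈ Metric.ball (0 : Plane) r := φ.tsupport_subset (h1 hx)
        show x ∈ Metric.ball (0 : Plane) r
        rw [mem_ball_zero_iff] at h2 ⊢
        refine lt_of_le_of_lt ?_ h2
        rw [norm_smul, norm_inv, Real.norm_of_nonneg h.1.le]
        exact le_mul_of_one_le_left (norm_nonneg x) ((one_le_inv₀ h.1).2 h.2) }
  else 0

theorem rescale_apply {r l : ℝ} (hl : 0 < l) (hl1 : l ≤ 1) (φ : 𝓓(ballO r, ℝ)) (x : Plane) :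
    rescale l φ x = (l ^ 2)⁻¹ * φ (l⁻¹ • x) := by
  unfold rescale
  rw [dif_pos ⟨hl, hl1⟩]
  rfl

/-- `λ ^ k (T|_{B_r})_λ → 0` in the sense of distributions on `B_r` as `λ → 0⁺`, for the
balls `B_r ⊆ Ω` about `O` (the condition does not depend on the choice of the ball). -/
def ScalesToZero {Ω : Opens Plane} (T : 𝓓'(Ω, ℝ)) (k : ℝ) : Prop :=
  ∀ r : ℝ, 0 < r → ballO r ≤ Ω → ∀ φ : 𝓓(ballO r, ℝ),
    Filter.Tendsto (fun l : ℝ => l ^ k * restrictTo (ballO r) T (rescale l φ)) (𝓝[>] 0) (𝓝 0)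

/-- The degree of divergence `deg T = sd T - 2` at `O`, where the scaling degree `sd T` is the
infimum in the extended reals of all real `k` with `λ ^ k T_λ → 0`. -/
def deg {Ω : Opens Plane} (T : 𝓓'(Ω, ℝ)) : EReal :=
  sInf ((fun k : ℝ => (k : EReal)) '' {k | ScalesToZero T k}) - 2

/-- The degree of divergence of a tensor field: `λ ^ k E_λ → 0` is required of all components. -/
def tensorDeg {Ω : Opens Plane} (E : Matrix (Fin 2) (Fin 2) 𝓓'(Ω, ℝ)) : EReal :=
  sInf ((fun k : ℝ => (k : EReal)) '' {k | ∀ i j, ScalesToZero (E i j) k}) - 2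

/-! ### Distributional and classical curl -/

/-- `Curl v = ∂₁ v₂ - ∂₂ v₁` for a vector valued distribution `v`. -/
def Curl {Ω : Opens Plane} (v : Fin 2 → 𝓓'(Ω, ℝ)) : 𝓓'(Ω, ℝ) :=
  ∂_{e 0} (v 1) - ∂_{e 1} (v 0)

/-- `⟨Curl V, a⟩ = Curl (Vᵀ a)`: the `i`-th component of `Curl V` is the curl of the `i`-th row. -/
def tensorCurl {Ω : Opens Plane} (V : Matrix (Fin 2) (Fin 2) 𝓓'(Ω, ℝ)) : Fin 2 → 𝓓'(Ω, ℝ) :=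
  fun i => Curl (V i)

/-- `curl f = ∂f₂/∂x₁ - ∂f₁/∂x₂` for a vector field `f` given by its components. -/
def curl (f : Fin 2 → Plane → ℝ) : Plane → ℝ :=
  fun y => fderiv ℝ (f 1) y (e 0) - fderiv ℝ (f 0) y (e 1)

/-- The row-wise curl of a tensor field given by its components. -/
def fieldCurl (V : Matrix (Fin 2) (Fin 2) (Plane → ℝ)) : Fin 2 → Plane → ℝ :=
  fun i => curl (V i)

/-! ### Point supported distributions -/

/-- `∂^α δ_O = ∂₁^{α₁} ∂₂^{α₂} δ_O`. -/
def derivDelta (Ω : Opens Plane) (α : ℕ × ℕ) : 𝓓'(Ω, ℝ) :=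
  (fun T : 𝓓'(Ω, ℝ) => ∂_{e 0} T)^[α.1]
    ((fun T : 𝓓'(Ω, ℝ) => ∂_{e 1} T)^[α.2] (Distribution.delta 0))

/-- The finite sum `∑ N^α ∂^α δ_O`. -/
def pointSupported (Ω : Opens Plane) (c : ℕ × ℕ →₀ ℝ) : 𝓓'(Ω, ℝ) :=
  c.sum fun α a => a • derivDelta Ω α

/-! ### The Cesàro loop integral -/

/-- The point `(ε cos t, ε sin t)` of the circle `∂B_ε`. -/
def circlePoint (ε t : ℝ) : Plane := !₂[ε * Real.cos t, ε * Real.sin t]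

/-- The velocity `(-ε sin t, ε cos t)` of the counterclockwise parametrisation of `∂B_ε`. -/
def circleVelocity (ε t : ℝ) : Plane := !₂[-(ε * Real.sin t), ε * Real.cos t]

/-- The tensor `E₀(y) + (y - x) × curl E₀(y)`. The planar curl `w = curl E₀(y)` stands for the
tensor `e₃ ⊗ w`, so that `(y - x) × curl E₀(y) = ((y - x) × e₃) ⊗ w`. -/
def cesaroKernel (E₀ : Matrix (Fin 2) (Fin 2) (Plane → ℝ)) (x y : Plane) :
    Matrix (Fin 2) (Fin 2) ℝ :=
  fun i j => E₀ i j y + crossE3 (y - x) i * fieldCurl E₀ j y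

/-- The line integral `∫_{∂B_ε} {E₀(y) + (y - x) × curl E₀(y)} dy`, counterclockwise. -/
def cesaroIntegral (E₀ : Matrix (Fin 2) (Fin 2) (Plane → ℝ)) (ε : ℝ) (x : Plane) : Plane :=
  WithLp.toLp 2 fun i => ∫ t in (0 : ℝ)..(2 * Real.pi),
    ∑ j, cesaroKernel E₀ x (circlePoint ε t) i j * circleVelocity ε t j

/-- The three local conditions: vanishing `curl curl` on `Ω - O`, the value of the Cesàro integral
over `∂B_ε`, and `deg N ≤ deg E + 2`. -/
def LocalConditions {Ω : Opens Plane} (E : Matrix (Fin 2) (Fin 2) 𝓓'(Ω, ℝ))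
    (E₀ : Matrix (Fin 2) (Fin 2) (Plane → ℝ)) (N : 𝓓'(Ω, ℝ)) (c : ℕ × ℕ →₀ ℝ) (ε : ℝ) : Prop :=
  (∀ y ∈ puncture Ω, curl (fieldCurl E₀) y = 0) ∧
  (∀ x ∈ puncture Ω,
    cesaroIntegral E₀ ε x = -(c (0, 1)) • e 0 + c (1, 0) • e 1 + c (0, 0) • e3Cross x) ∧
  deg N ≤ tensorDeg E + 2

end PlanarIncompatibility

end

/-!
For an affine function `q` and a radial cutoff function `χ` equal to `1` near `O`, the number
`⟨Curl Curl E, q χ⟩` can be computed in two ways. If `Curl Curl E = N`, it is a combination of the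
coefficients of `N` of order at most one, because `q χ` is affine near `O`. On the other hand, for
`q` the `i`-th component of `y ↦ (y - x) × e₃`, the distributional derivatives can be moved onto
`χ` so that only `∂₁χ` and `∂₂χ` remain; these vanish near `O`, where `E` may be singular, and what
is left is the integral `-∫ (∂₁χ w₂ - ∂₂χ w₁)`, with `w` the `i`-th row of the Cesàro kernel. That
row is a closed one-form off the origin when `curl curl E₀ = 0`, so its integrals over circles
about `O` agree, and in polar coordinates the integral above is the loop integral of `w` over
`∂B_ε` (`integral_cutoff_eq_neg_loopIntegral`, `curl_tensorCurl_apply_cutoff`). Comparing the two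
values gives the formula for the Cesàro integral. The vanishing of `curl curl E₀` is the fundamental
lemma of the calculus of variations, and the degree estimate holds because each derivative raises
the scaling degree by at most one (`deg_curl_tensorCurl_le`).

For the converse, let `M = Curl Curl E - N`. It is supported at `O`, and by the degree hypotheses
its scaling degree is less than `4`. Such a distribution is a combination of `δ_O` and its first
derivatives (`eq_zero_of_isSupportedAtOrigin`): it has finite order, so it kills functions
vanishing at `O` to high order; a cut off monomial of degree `d ≥ 2` is killed since rescaling
multiplies it by a power of `l` that beats the scaling degree; and Hadamard's lemma connects the
two by downward induction on the order of vanishing. Finally the three remaining coefficients of `M`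
vanish because the Cesàro integral has the prescribed value for all `x`.
-/

noncomputable section

namespace PlanarIncompatibility

open MeasureTheory Filter

/-! ### Test functions and distributions -/

theorem lineDeriv_testFunction_apply {U : Opens Plane} (v : Plane) (φ : 𝓓(U, ℝ)) (x : Plane) :
    (∂_{v} φ : 𝓓(U, ℝ)) x = fderiv ℝ φ x v := by
  rw [TestFunction.lineDerivOp_eq_lineDerivCLM ℝ, TestFunction.lineDerivCLM_eq_fderivCLM,
    TestFunction.fderivCLM_apply_of_le φ (by simp)]

theorem lineDeriv_distribution_apply {U : Opens Plane} (v : Plane) (T : 𝓓'(U, ℝ)) (φ : 𝓓(U, ℝ)) :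
    (∂_{v} T : 𝓓'(U, ℝ)) φ = -T (∂_{v} φ) := by
  rw [Distribution.lineDerivOp_apply_apply, map_neg]

theorem coe_monoCLM {U V : Opens Plane} (h : U ≤ V) (φ : 𝓓(U, ℝ)) :
    ((TestFunction.monoCLM ℝ φ : 𝓓(V, ℝ)) : Plane → ℝ) = φ := by
  simp [h]

/-- The product `g φ` of a smooth function `g` and a test function `φ`. -/
def smoothMul {U : Opens Plane} (g : Plane → ℝ) (hg : ContDiff ℝ ∞ g) (φ : 𝓓(U, ℝ)) :
    𝓓(U, ℝ) where
  toFun x := g x * φ x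
  contDiff' := hg.mul φ.contDiff
  hasCompactSupport' := φ.hasCompactSupport.mul_left
  tsupport_subset' := tsupport_mul_subset_right.trans φ.tsupport_subset

theorem smoothMul_apply {U : Opens Plane} (g : Plane → ℝ) (hg : ContDiff ℝ ∞ g) (φ : 𝓓(U, ℝ))
    (x : Plane) : smoothMul g hg φ x = g x * φ x := rfl

theorem puncture_le (Ω : Opens Plane) : puncture Ω ≤ Ω := fun _ hx => hx.1

/-- The distribution `T` on `Ω` is given by the function `f`, smooth on `Ω - O`, on all test
functions on `Ω` that vanish near `O`. Working with test functions on `Ω` itself avoids passing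
to the restriction of `T` to `Ω - O`. -/
def HasDensityOffOrigin {Ω : Opens Plane} (T : 𝓓'(Ω, ℝ)) (f : Plane → ℝ) : Prop :=
  ContDiffOn ℝ ∞ f (puncture Ω : Set Plane) ∧
    ∀ φ : 𝓓(Ω, ℝ), (φ : Plane → ℝ) =ᶠ[𝓝 0] 0 → T φ = ∫ x, f x * φ x

theorem tsupport_subset_puncture {Ω : Opens Plane} {φ : 𝓓(Ω, ℝ)}
    (hφ : (φ : Plane → ℝ) =ᶠ[𝓝 0] 0) : tsupport φ ⊆ (puncture Ω : Set Plane) := by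
  intro x hx
  refine ⟨φ.tsupport_subset hx, fun h0 => ?_⟩
  rw [mem_singleton_iff.1 h0] at hx
  exact notMem_tsupport_iff_eventuallyEq.2 hφ hx

theorem contDiff_mul_testFunction {Ω : Opens Plane} {f : Plane → ℝ}
    (hf : ContDiffOn ℝ ∞ f (puncture Ω : Set Plane)) {φ : 𝓓(Ω, ℝ)}
    (hφ : (φ : Plane → ℝ) =ᶠ[𝓝 0] 0) : ContDiff ℝ ∞ fun x => f x * φ x := by
  refine contDiff_iff_contDiffAt.2 fun x => ?_
  by_cases hx : x ∈ tsupport φ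
  · exact (hf.contDiffAt ((puncture Ω).isOpen.mem_nhds
      (tsupport_subset_puncture hφ hx))).mul φ.contDiff.contDiffAt
  · refine (contDiffAt_const (c := (0 : ℝ))).congr_of_eventuallyEq ?_
    filter_upwards [notMem_tsupport_iff_eventuallyEq.1 hx] with y hy
    simp [hy]

theorem integrable_mul_testFunction {Ω : Opens Plane} {f : Plane → ℝ}
    (hf : ContDiffOn ℝ ∞ f (puncture Ω : Set Plane)) {φ : 𝓓(Ω, ℝ)}
    (hφ : (φ : Plane → ℝ) =ᶠ[𝓝 0] 0) : Integrable fun x => f x * φ x :=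
  (contDiff_mul_testFunction hf hφ).continuous.integrable_of_hasCompactSupport
    φ.hasCompactSupport.mul_left

theorem integral_fderiv_eq_zero {F : Plane → ℝ} (hF : ContDiff ℝ ∞ F) (hc : HasCompactSupport F)
    (v : Plane) : ∫ x, fderiv ℝ F x v = 0 := by
  have hd : Continuous fun x => fderiv ℝ F x v :=
    (hF.continuous_fderiv (by simp)).clm_apply continuous_const
  have hi : Integrable fun x => fderiv ℝ F x v :=
    hd.integrable_of_hasCompactSupport (hc.fderiv_apply ℝ v)
  have := integral_mul_fderiv_eq_neg_fderiv_mul_of_integrable (μ := (volume : Measure Plane))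
    (f := fun _ => (1 : ℝ)) (g := F) (v := v) (by simp) (by simpa using hi)
    (by simpa using hF.continuous.integrable_of_hasCompactSupport hc)
    (fun x _ => differentiableAt_const _)
    (fun x _ => (hF.differentiable (by simp)).differentiableAt)
  simpa using this

theorem contDiffOn_fderiv_apply {Ω : Opens Plane} {f : Plane → ℝ}
    (hf : ContDiffOn ℝ ∞ f (puncture Ω : Set Plane)) (v : Plane) :
    ContDiffOn ℝ ∞ (fun x => fderiv ℝ f x v) (puncture Ω : Set Plane) :=
  (hf.fderiv_of_isOpen (puncture Ω).isOpen (by simp)).clm_apply contDiffOn_const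

theorem lineDeriv_eventuallyEq_zero {Ω : Opens Plane} {φ : 𝓓(Ω, ℝ)}
    (hφ : (φ : Plane → ℝ) =ᶠ[𝓝 0] 0) (v : Plane) :
    ((∂_{v} φ : 𝓓(Ω, ℝ)) : Plane → ℝ) =ᶠ[𝓝 0] 0 := by
  filter_upwards [hφ.fderiv (𝕜 := ℝ)] with x hx
  rw [lineDeriv_testFunction_apply, hx]
  simp

/-- Integration by parts on `Ω - O`. -/
theorem HasDensityOffOrigin.lineDeriv {Ω : Opens Plane} {T : 𝓓'(Ω, ℝ)} {f : Plane → ℝ}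
    (h : HasDensityOffOrigin T f) (v : Plane) :
    HasDensityOffOrigin (∂_{v} T) fun x => fderiv ℝ f x v := by
  refine ⟨contDiffOn_fderiv_apply h.1 v, fun φ hφ => ?_⟩
  have hφ' := lineDeriv_eventuallyEq_zero hφ v
  rw [lineDeriv_distribution_apply, h.2 _ hφ', neg_eq_iff_add_eq_zero,
    ← integral_add (integrable_mul_testFunction h.1 hφ')
      (integrable_mul_testFunction (contDiffOn_fderiv_apply h.1 v) hφ)]
  rw [← integral_fderiv_eq_zero (contDiff_mul_testFunction h.1 hφ)
    φ.hasCompactSupport.mul_left v]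
  refine integral_congr_ae (ae_of_all _ fun x => ?_)
  simp only [lineDeriv_testFunction_apply]
  by_cases hx : x ∈ tsupport φ
  · have hx' := tsupport_subset_puncture hφ hx
    have h1 : DifferentiableAt ℝ f x :=
      (h.1.contDiffAt ((puncture Ω).isOpen.mem_nhds hx')).differentiableAt (by simp)
    have h2 : DifferentiableAt ℝ φ x := φ.contDiff.contDiffAt.differentiableAt (by simp)
    rw [fderiv_fun_mul h1 h2]
    simp [mul_comm]
  · have h0 : (φ : Plane → ℝ) =ᶠ[𝓝 x] 0 := notMem_tsupport_iff_eventuallyEq.1 hx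
    have h1 : (fun y => f y * φ y) =ᶠ[𝓝 x] 0 := by
      filter_upwards [h0] with y hy
      simp [hy]
    rw [h0.fderiv_eq, h1.fderiv_eq, h0.eq_of_nhds]
    simp

theorem HasDensityOffOrigin.sub {Ω : Opens Plane} {S T : 𝓓'(Ω, ℝ)} {f g : Plane → ℝ}
    (hS : HasDensityOffOrigin S f) (hT : HasDensityOffOrigin T g) :
    HasDensityOffOrigin (S - T) fun x => f x - g x := by
  refine ⟨hS.1.sub hT.1, fun φ hφ => ?_⟩
  change S φ - T φ = _
  rw [hS.2 φ hφ, hT.2 φ hφ, ← integral_sub (integrable_mul_testFunction hS.1 hφ)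
    (integrable_mul_testFunction hT.1 hφ)]
  simp only [sub_mul]

theorem IsSmoothDensity.hasDensityOffOrigin {Ω : Opens Plane} {T : 𝓓'(Ω, ℝ)} {f : Plane → ℝ}
    (h : IsSmoothDensity (restrictTo (puncture Ω) T) f) : HasDensityOffOrigin T f := by
  refine ⟨h.1, fun φ hφ => ?_⟩
  have hs := tsupport_subset_puncture hφ
  let ψ : 𝓓(puncture Ω, ℝ) := ⟨φ, φ.contDiff, φ.hasCompactSupport, hs⟩
  have hψ : (TestFunction.monoCLM ℝ ψ : 𝓓(Ω, ℝ)) = φ := by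
    ext x
    rw [coe_monoCLM (puncture_le Ω)]
    rfl
  have := h.2 ψ
  rw [restrictTo_apply, hψ] at this
  rw [this]
  refine setIntegral_eq_integral_of_forall_compl_eq_zero fun x hx => ?_
  have : φ x = 0 := image_eq_zero_of_notMem_tsupport fun hx' => hx (hs hx')
  change f x * φ x = 0
  rw [this, mul_zero]

/-- The fundamental lemma of the calculus of variations on `Ω - O`. -/
theorem HasDensityOffOrigin.eq_zero {Ω : Opens Plane} {T : 𝓓'(Ω, ℝ)} {f : Plane → ℝ}
    (h : HasDensityOffOrigin T f)
    (hT : ∀ φ : 𝓓(Ω, ℝ), (φ : Plane → ℝ) =ᶠ[𝓝 0] 0 → T φ = 0) :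
    ∀ y ∈ puncture Ω, f y = 0 := by
  have hae : ∀ᵐ x, x ∈ (puncture Ω : Set Plane) → f x = 0 := by
    refine (puncture Ω).isOpen.ae_eq_zero_of_integral_contDiff_smul_eq_zero
      (h.1.continuousOn.locallyIntegrableOn (puncture Ω).isOpen.measurableSet) ?_
    intro g hg hgc hgs
    let φ : 𝓓(Ω, ℝ) := ⟨g, hg, hgc, hgs.trans (puncture_le Ω)⟩
    have hφ : (φ : Plane → ℝ) =ᶠ[𝓝 0] 0 :=
      notMem_tsupport_iff_eventuallyEq.1 fun h0 => (hgs h0).2 rfl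
    rw [← hT φ hφ, h.2 φ hφ]
    exact integral_congr_ae (ae_of_all _ fun x => mul_comm _ _)
  have hr : f =ᵐ[volume.restrict (puncture Ω : Set Plane)] fun _ => 0 := by
    rw [Filter.EventuallyEq, ae_restrict_iff' (puncture Ω).isOpen.measurableSet]
    exact hae
  exact fun y hy => Measure.eqOn_open_of_ae_eq hr (puncture Ω).isOpen h.1.continuousOn
    continuousOn_const hy

/-! ### Point supported distributions -/

/-- `T` vanishes on the test functions that vanish near `O`. -/
def IsSupportedAtOrigin {Ω : Opens Plane} (T : 𝓓'(Ω, ℝ)) : Prop :=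
  ∀ φ : 𝓓(Ω, ℝ), (φ : Plane → ℝ) =ᶠ[𝓝 0] 0 → T φ = 0

theorem IsSupportedAtOrigin.lineDeriv {Ω : Opens Plane} {T : 𝓓'(Ω, ℝ)}
    (hT : IsSupportedAtOrigin T) (v : Plane) : IsSupportedAtOrigin (∂_{v} T : 𝓓'(Ω, ℝ)) :=
  fun φ hφ => by
    rw [lineDeriv_distribution_apply, hT _ (lineDeriv_eventuallyEq_zero hφ v), neg_zero]

theorem IsSupportedAtOrigin.congr {Ω : Opens Plane} {T : 𝓓'(Ω, ℝ)}
    (hT : IsSupportedAtOrigin T) {φ ψ : 𝓓(Ω, ℝ)} (h : (φ : Plane → ℝ) =ᶠ[𝓝 0] ψ) :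
    T φ = T ψ := by
  rw [← sub_eq_zero, ← map_sub]
  refine hT _ ?_
  filter_upwards [h] with x hx
  change φ x - ψ x = 0
  rw [hx, sub_self]

theorem isSupportedAtOrigin_derivDelta (Ω : Opens Plane) (α : ℕ × ℕ) :
    IsSupportedAtOrigin (derivDelta Ω α) := by
  obtain ⟨a, b⟩ := α
  have h0 : IsSupportedAtOrigin (Distribution.delta 0 : 𝓓'(Ω, ℝ)) := fun φ hφ => by
    rw [Distribution.delta_apply, hφ.eq_of_nhds]; rfl
  have h1 : IsSupportedAtOrigin (derivDelta Ω (0, b)) := by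
    induction b with
    | zero => exact h0
    | succ b ih =>
      simp only [derivDelta, Function.iterate_zero, id, Function.iterate_succ_apply'] at ih ⊢
      exact ih.lineDeriv _
  induction a with
  | zero => exact h1
  | succ a ih =>
    simp only [derivDelta, Function.iterate_succ_apply'] at ih ⊢
    exact ih.lineDeriv _

theorem pointSupported_apply (Ω : Opens Plane) (c : ℕ × ℕ →₀ ℝ) (φ : 𝓓(Ω, ℝ)) :
    pointSupported Ω c φ = c.sum fun α a => a * derivDelta Ω α φ := by
  have h : ∀ (s : Finset (ℕ × ℕ)) (F : ℕ × ℕ → 𝓓'(Ω, ℝ)),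
      (∑ α ∈ s, F α : 𝓓'(Ω, ℝ)) φ = ∑ α ∈ s, F α φ := by
    intro s F
    induction s using Finset.cons_induction with
    | empty => rfl
    | cons a s ha ih => rw [Finset.sum_cons, Finset.sum_cons, ← ih]; rfl
  rw [pointSupported, Finsupp.sum, h]
  rfl

theorem isSupportedAtOrigin_pointSupported (Ω : Opens Plane) (c : ℕ × ℕ →₀ ℝ) :
    IsSupportedAtOrigin (pointSupported Ω c) := fun φ hφ => by
  rw [pointSupported_apply]
  refine Finset.sum_eq_zero fun α _ => ?_
  simp only [isSupportedAtOrigin_derivDelta Ω α φ hφ, mul_zero]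

theorem e_apply (i j : Fin 2) : e i j = if j = i then 1 else 0 := by
  simp [e]

theorem fderiv_affine (a b d : ℝ) (x v : Plane) :
    fderiv ℝ (fun y : Plane => a + b * y 0 + d * y 1) x v = b * v 0 + d * v 1 := by
  have h0 : HasFDerivAt (fun y : Plane => y 0) (EuclideanSpace.proj 0 : Plane →L[ℝ] ℝ) x :=
    (EuclideanSpace.proj 0 : Plane →L[ℝ] ℝ).hasFDerivAt
  have h1 : HasFDerivAt (fun y : Plane => y 1) (EuclideanSpace.proj 1 : Plane →L[ℝ] ℝ) x :=
    (EuclideanSpace.proj 1 : Plane →L[ℝ] ℝ).hasFDerivAt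
  have := ((h0.const_mul b).const_add a).add (h1.const_mul d)
  have h : (fun y : Plane => a + b * y 0 + d * y 1) =
      (fun y : Plane => a + b * y 0) + fun y => d * y 1 := rfl
  rw [h, this.fderiv]
  simp

theorem lineDeriv_eventuallyEq_const {Ω : Opens Plane} {φ : 𝓓(Ω, ℝ)} {a b d : ℝ}
    (hφ : (φ : Plane → ℝ) =ᶠ[𝓝 0] fun y => a + b * y 0 + d * y 1) (v : Plane) :
    ((∂_{v} φ : 𝓓(Ω, ℝ)) : Plane → ℝ) =ᶠ[𝓝 0]
      fun y => (b * v 0 + d * v 1) + 0 * y 0 + 0 * y 1 := by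
  filter_upwards [hφ.fderiv (𝕜 := ℝ)] with x hx
  rw [lineDeriv_testFunction_apply, hx, fderiv_affine]
  ring

/-- Derivatives of `δ_O` of order at least two do not see functions that are affine near `O`. -/
theorem derivDelta_apply_of_affine (Ω : Opens Plane) (α : ℕ × ℕ) {φ : 𝓓(Ω, ℝ)} {a b d : ℝ}
    (hφ : (φ : Plane → ℝ) =ᶠ[𝓝 0] fun y => a + b * y 0 + d * y 1) :
    derivDelta Ω α φ = (if α = (0, 0) then a else 0) - (if α = (1, 0) then b else 0)
      - (if α = (0, 1) then d else 0) := by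
  have key : ∀ (T : 𝓓'(Ω, ℝ)) (v w : Plane), IsSupportedAtOrigin T →
      (∂_{v} (∂_{w} T : 𝓓'(Ω, ℝ)) : 𝓓'(Ω, ℝ)) φ = 0 := by
    intro T v w hT
    rw [lineDeriv_distribution_apply, lineDeriv_distribution_apply, neg_neg]
    refine hT _ ?_
    filter_upwards [lineDeriv_eventuallyEq_const (lineDeriv_eventuallyEq_const hφ v) w] with y hy
    rw [hy]
    simp
  have h0 : ∀ {ψ : 𝓓(Ω, ℝ)} {a b d : ℝ},
      (ψ : Plane → ℝ) =ᶠ[𝓝 0] (fun y => a + b * y 0 + d * y 1) →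
      (Distribution.delta 0 : 𝓓'(Ω, ℝ)) ψ = a := by
    intro ψ a b d h
    rw [Distribution.delta_apply, h.eq_of_nhds]
    simp
  obtain ⟨m, n⟩ := α
  match m, n with
  | 0, 0 => simpa [derivDelta] using h0 hφ
  | 0, 1 =>
    have : derivDelta Ω (0, 1) = ∂_{e 1} (Distribution.delta 0 : 𝓓'(Ω, ℝ)) := rfl
    rw [this, lineDeriv_distribution_apply, h0 (lineDeriv_eventuallyEq_const hφ _)]
    simp [e_apply]
  | 1, 0 =>
    have : derivDelta Ω (1, 0) = ∂_{e 0} (Distribution.delta 0 : 𝓓'(Ω, ℝ)) := rfl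
    rw [this, lineDeriv_distribution_apply, h0 (lineDeriv_eventuallyEq_const hφ _)]
    simp [e_apply]
  | 0, n + 2 =>
    have : derivDelta Ω (0, n + 2) = ∂_{e 1} (∂_{e 1} (derivDelta Ω (0, n))) := by
      simp only [derivDelta, Function.iterate_zero, id, Function.iterate_succ_apply']
    rw [this, key _ _ _ (isSupportedAtOrigin_derivDelta Ω _)]
    simp
  | 1, n + 1 =>
    have : derivDelta Ω (1, n + 1) = ∂_{e 0} (∂_{e 1} (derivDelta Ω (0, n))) := by
      simp only [derivDelta, Function.iterate_zero, id, Function.iterate_succ_apply']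
    rw [this, key _ _ _ (isSupportedAtOrigin_derivDelta Ω _)]
    simp
  | m + 2, n =>
    have : derivDelta Ω (m + 2, n) = ∂_{e 0} (∂_{e 0} (derivDelta Ω (m, n))) := by
      simp only [derivDelta, Function.iterate_succ_apply']
    rw [this, key _ _ _ (isSupportedAtOrigin_derivDelta Ω _)]
    simp

theorem pointSupported_apply_of_affine (Ω : Opens Plane) (c : ℕ × ℕ →₀ ℝ) {φ : 𝓓(Ω, ℝ)}
    {a b d : ℝ} (hφ : (φ : Plane → ℝ) =ᶠ[𝓝 0] fun y => a + b * y 0 + d * y 1) :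
    pointSupported Ω c φ = c (0, 0) * a - c (1, 0) * b - c (0, 1) * d := by
  rw [pointSupported_apply]
  simp only [derivDelta_apply_of_affine Ω _ hφ, mul_sub, mul_ite, mul_zero, Finsupp.sum_sub]
  simp [Finsupp.sum]
  split_ifs <;> simp_all

/-! ### Scaling degree -/

theorem ScalesToZero.mono {Ω : Opens Plane} {T : 𝓓'(Ω, ℝ)} {k k' : ℝ} (h : ScalesToZero T k)
    (hk : k ≤ k') : ScalesToZero T k' := by
  intro r hr hrΩ φ
  refine squeeze_zero_norm' ?_ (tendsto_zero_iff_norm_tendsto_zero.1 (h r hr hrΩ φ))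
  filter_upwards [Ioc_mem_nhdsGT (zero_lt_one' ℝ)] with l hl
  rw [norm_mul, norm_mul]
  refine mul_le_mul_of_nonneg_right ?_ (norm_nonneg _)
  rw [Real.norm_of_nonneg (Real.rpow_nonneg hl.1.le _),
    Real.norm_of_nonneg (Real.rpow_nonneg hl.1.le _)]
  exact Real.rpow_le_rpow_of_exponent_ge hl.1 hl.2 hk

theorem ScalesToZero.sub {Ω : Opens Plane} {S T : 𝓓'(Ω, ℝ)} {k : ℝ} (hS : ScalesToZero S k)
    (hT : ScalesToZero T k) : ScalesToZero (S - T) k := by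
  intro r hr hrΩ φ
  have := (hS r hr hrΩ φ).sub (hT r hr hrΩ φ)
  rw [sub_zero] at this
  refine this.congr fun l => ?_
  rw [← mul_sub]
  rfl

theorem lineDeriv_rescale {r l : ℝ} (hl : 0 < l) (hl1 : l ≤ 1) (φ : 𝓓(ballO r, ℝ)) (v : Plane) :
    (∂_{v} (rescale l φ) : 𝓓(ballO r, ℝ)) = l⁻¹ • rescale l (∂_{v} φ) := by
  ext x
  change _ = l⁻¹ * rescale l (∂_{v} φ) x
  rw [lineDeriv_testFunction_apply, rescale_apply hl hl1, lineDeriv_testFunction_apply]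
  have h1 : HasFDerivAt φ (fderiv ℝ φ (l⁻¹ • x)) (l⁻¹ • x) :=
    (φ.contDiff.contDiffAt.differentiableAt (by simp)).hasFDerivAt
  have h2 : HasFDerivAt (fun x : Plane => l⁻¹ • x) (l⁻¹ • ContinuousLinearMap.id ℝ Plane) x :=
    (hasFDerivAt_id x).const_smul l⁻¹
  have h3 := ((h1.comp x h2).const_mul (l ^ 2)⁻¹).congr_of_eventuallyEq
    (Eventually.of_forall (rescale_apply hl hl1 φ))
  rw [h3.fderiv]
  simp
  ring

theorem restrictTo_lineDeriv {Ω U : Opens Plane} (h : U ≤ Ω) (T : 𝓓'(Ω, ℝ)) (v : Plane)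
    (φ : 𝓓(U, ℝ)) : restrictTo U (∂_{v} T) φ = -restrictTo U T (∂_{v} φ) := by
  rw [restrictTo_apply, restrictTo_apply, lineDeriv_distribution_apply]
  congr 2
  ext x
  rw [lineDeriv_testFunction_apply, coe_monoCLM h, coe_monoCLM h, lineDeriv_testFunction_apply]

/-- Differentiation raises the scaling degree by at most one. -/
theorem ScalesToZero.lineDeriv {Ω : Opens Plane} {T : 𝓓'(Ω, ℝ)} {k : ℝ} (h : ScalesToZero T k)
    (v : Plane) : ScalesToZero (∂_{v} T : 𝓓'(Ω, ℝ)) (k + 1) := by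
  intro r hr hrΩ φ
  have := (h r hr hrΩ (∂_{v} φ)).neg
  rw [neg_zero] at this
  refine this.congr' ?_
  filter_upwards [Ioc_mem_nhdsGT (zero_lt_one' ℝ)] with l hl
  rw [restrictTo_lineDeriv hrΩ, lineDeriv_rescale hl.1 hl.2, map_smul, Real.rpow_add hl.1,
    Real.rpow_one, smul_eq_mul]
  have := hl.1.ne'
  field_simp

theorem scalesToZero_curl_tensorCurl {Ω : Opens Plane} {E : Matrix (Fin 2) (Fin 2) 𝓓'(Ω, ℝ)}
    {k : ℝ} (h : ∀ i j, ScalesToZero (E i j) k) : ScalesToZero (Curl (tensorCurl E)) (k + 2) := by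
  have h1 : ∀ i, ScalesToZero (tensorCurl E i) (k + 1) := fun i =>
    ((h i 1).lineDeriv _).sub ((h i 0).lineDeriv _)
  have := ((h1 1).lineDeriv (e 0)).sub ((h1 0).lineDeriv (e 1))
  rw [add_assoc, one_add_one_eq_two] at this
  exact this

theorem deg_curl_tensorCurl_le {Ω : Opens Plane} (E : Matrix (Fin 2) (Fin 2) 𝓓'(Ω, ℝ)) :
    deg (Curl (tensorCurl E)) ≤ tensorDeg E + 2 := by
  have h2 : ∀ x : EReal, x - 2 + 2 = x := fun x => EReal.sub_add_cancel (b := 2)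
  rw [tensorDeg, h2, deg]
  refine le_sInf ?_
  rintro _ ⟨k, hk, rfl⟩
  have h1 : sInf ((fun k : ℝ => (k : EReal)) '' {k | ScalesToZero (Curl (tensorCurl E)) k})
      ≤ ((k + 2 : ℝ) : EReal) := sInf_le ⟨k + 2, scalesToZero_curl_tensorCurl hk, rfl⟩
  have h3 : ((k + 2 : ℝ) : EReal) - 2 = ((k + 2 - 2 : ℝ) : EReal) := rfl
  rw [add_sub_cancel_right] at h3
  exact (EReal.sub_le_sub h1 le_rfl).trans h3.le

theorem exists_lt_of_sInf_sub_two_lt {s : Set ℝ} {a : ℝ}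
    (h : sInf ((fun k : ℝ => (k : EReal)) '' s) - 2 < (a : EReal)) : ∃ k ∈ s, k < a + 2 := by
  have h' : sInf ((fun k : ℝ => (k : EReal)) '' s) < ((a + 2 : ℝ) : EReal) := by
    have := EReal.add_lt_add_right_coe h 2
    have h2 : ∀ x : EReal, x - 2 + ((2 : ℝ) : EReal) = x := fun x => EReal.sub_add_cancel (b := 2)
    rwa [h2] at this
  obtain ⟨_, ⟨k, hk, rfl⟩, hlt⟩ := sInf_lt_iff.1 h'
  exact ⟨k, hk, EReal.coe_lt_coe_iff.1 hlt⟩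

/-- If `deg E < 0` and `deg N ≤ deg E + 2`, then the scaling degree of `Curl Curl E - N` is
less than `4`, that of a second derivative of `δ_O`. -/
theorem exists_scalesToZero_curl_tensorCurl_sub {Ω : Opens Plane}
    {E : Matrix (Fin 2) (Fin 2) 𝓓'(Ω, ℝ)} {N : 𝓓'(Ω, ℝ)} (hE : tensorDeg E < 0)
    (hN : deg N ≤ tensorDeg E + 2) :
    ∃ k < 4, ScalesToZero (Curl (tensorCurl E) - N) k := by
  obtain ⟨k, hk, hk2⟩ := exists_lt_of_sInf_sub_two_lt (a := 0) hE
  have hN2 : deg N < ((2 : ℝ) : EReal) := by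
    refine hN.trans_lt ?_
    have := EReal.add_lt_add_right_coe hE 2
    rwa [zero_add] at this
  obtain ⟨m, hm, hm2⟩ := exists_lt_of_sInf_sub_two_lt hN2
  refine ⟨max (k + 2) m, max_lt (by linarith) (by linarith), ?_⟩
  exact ((scalesToZero_curl_tensorCurl hk).mono (le_max_left _ _)).sub (hm.mono (le_max_right _ _))

/-! ### Loop integrals of closed one-forms -/

/-- The counterclockwise line integral of the one-form `w₀ dy₁ + w₁ dy₂` over `∂B_s`. -/
def loopIntegral (w : Fin 2 → Plane → ℝ) (s : ℝ) : ℝ :=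
  ∫ t in (0 : ℝ)..(2 * Real.pi), ∑ j, w j (circlePoint s t) * circleVelocity s t j

theorem circlePoint_eq (s t : ℝ) :
    circlePoint s t = (s * Real.cos t) • e 0 + (s * Real.sin t) • e 1 := by
  ext i
  fin_cases i <;> simp [circlePoint, e_apply]

theorem norm_circlePoint_sq (s t : ℝ) : ‖circlePoint s t‖ ^ 2 = s ^ 2 := by
  rw [EuclideanSpace.norm_sq_eq]
  simp only [circlePoint, Fin.sum_univ_two, Real.norm_eq_abs, sq_abs, Matrix.cons_val_zero,
    Matrix.cons_val_one]
  linear_combination s ^ 2 * Real.cos_sq_add_sin_sq t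

theorem norm_circlePoint {s : ℝ} (hs : 0 ≤ s) (t : ℝ) : ‖circlePoint s t‖ = s := by
  have := norm_circlePoint_sq s t
  exact (sq_eq_sq₀ (norm_nonneg _) hs).1 this

theorem contDiff_circlePoint : ContDiff ℝ ∞ fun p : ℝ × ℝ => circlePoint p.1 p.2 := by
  simp only [circlePoint_eq]
  have h1 : ContDiff ℝ ∞ fun p : ℝ × ℝ => Real.cos p.2 := Real.contDiff_cos.comp contDiff_snd
  have h2 : ContDiff ℝ ∞ fun p : ℝ × ℝ => Real.sin p.2 := Real.contDiff_sin.comp contDiff_snd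
  exact ((contDiff_fst.mul h1).smul contDiff_const).add ((contDiff_fst.mul h2).smul contDiff_const)

theorem circlePoint_mem_puncture {Ω : Opens Plane} {ε s : ℝ}
    (hball : Metric.closedBall (0 : Plane) ε ⊆ Ω) (hs : 0 < s) (hsε : s ≤ ε) (t : ℝ) :
    circlePoint s t ∈ puncture Ω := by
  refine ⟨hball ?_, fun h => ?_⟩
  · rw [mem_closedBall_zero_iff, norm_circlePoint hs.le]
    exact hsε
  · have := norm_circlePoint hs.le t
    rw [mem_singleton_iff.1 h, norm_zero] at this
    exact hs.ne this

theorem hasDerivAt_comp_circlePoint_radius {f : Plane → ℝ} {s t : ℝ}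
    (hf : DifferentiableAt ℝ f (circlePoint s t)) :
    HasDerivAt (fun s => f (circlePoint s t))
      (Real.cos t * fderiv ℝ f (circlePoint s t) (e 0)
        + Real.sin t * fderiv ℝ f (circlePoint s t) (e 1)) s := by
  have h : HasDerivAt (fun s => circlePoint s t)
      ((1 * Real.cos t) • e 0 + (1 * Real.sin t) • e 1) s := by
    simp only [circlePoint_eq]
    exact (((hasDerivAt_id s).mul_const _).smul_const _).add
      (((hasDerivAt_id s).mul_const _).smul_const _)
  have := hf.hasFDerivAt.comp_hasDerivAt s h
  refine this.congr_deriv ?_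
  simp

theorem hasDerivAt_comp_circlePoint_angle {f : Plane → ℝ} {s t : ℝ}
    (hf : DifferentiableAt ℝ f (circlePoint s t)) :
    HasDerivAt (fun t => f (circlePoint s t))
      (-(s * Real.sin t) * fderiv ℝ f (circlePoint s t) (e 0)
        + s * Real.cos t * fderiv ℝ f (circlePoint s t) (e 1)) t := by
  have h : HasDerivAt (fun t => circlePoint s t)
      ((s * -Real.sin t) • e 0 + (s * Real.cos t) • e 1) t := by
    simp only [circlePoint_eq]
    exact (((Real.hasDerivAt_cos t).const_mul s).smul_const _).add
      (((Real.hasDerivAt_sin t).const_mul s).smul_const _)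
  have := hf.hasFDerivAt.comp_hasDerivAt t h
  refine this.congr_deriv ?_
  simp

/-- The pull-back of a closed one-form to polar coordinates `(s, t)` is closed, and its
`ds`-component is `2π`-periodic in `t`. Hence its integrals over concentric circles agree. -/
theorem loopIntegral_eq_of_closed {Ω : Opens Plane} {w : Fin 2 → Plane → ℝ}
    (hw : ∀ j, ContDiffOn ℝ ∞ (w j) (puncture Ω : Set Plane))
    (hcurl : ∀ y ∈ puncture Ω, curl w y = 0) {ε s : ℝ}
    (hball : Metric.closedBall (0 : Plane) ε ⊆ Ω) (hs : 0 < s) (hsε : s ≤ ε) :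
    loopIntegral w s = loopIntegral w ε := by
  -- In polar coordinates the form is `-g ds + f dt`, so closedness says `∂ₛ f + ∂ₜ g = 0`.
  let f : ℝ × ℝ → ℝ := fun p => w 0 (circlePoint p.1 p.2) * -(p.1 * Real.sin p.2)
    + w 1 (circlePoint p.1 p.2) * (p.1 * Real.cos p.2)
  let g : ℝ × ℝ → ℝ := fun p => -(w 0 (circlePoint p.1 p.2) * Real.cos p.2
    + w 1 (circlePoint p.1 p.2) * Real.sin p.2)
  have hmem : ∀ p : ℝ × ℝ, p.1 ∈ Icc s ε → circlePoint p.1 p.2 ∈ puncture Ω := fun p hp =>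
    circlePoint_mem_puncture hball (hs.trans_le hp.1) hp.2 _
  have hwd : ∀ (p : ℝ × ℝ) (j : Fin 2), p.1 ∈ Icc s ε →
      DifferentiableAt ℝ (w j) (circlePoint p.1 p.2) := fun p j hp =>
    ((hw j).contDiffAt ((puncture Ω).isOpen.mem_nhds (hmem p hp))).differentiableAt (by simp)
  have hγ : ∀ p : ℝ × ℝ, DifferentiableAt ℝ (fun p : ℝ × ℝ => circlePoint p.1 p.2) p := fun p =>
    contDiff_circlePoint.contDiffAt.differentiableAt (by simp)
  have hwγ : ∀ (p : ℝ × ℝ) (j : Fin 2), p.1 ∈ Icc s ε →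
      DifferentiableAt ℝ (fun p : ℝ × ℝ => w j (circlePoint p.1 p.2)) p := fun p j hp =>
    (hwd p j hp).comp p (hγ p)
  have hsin : ∀ p : ℝ × ℝ, DifferentiableAt ℝ (fun p : ℝ × ℝ => Real.sin p.2) p := fun p => by
    fun_prop
  have hcos : ∀ p : ℝ × ℝ, DifferentiableAt ℝ (fun p : ℝ × ℝ => Real.cos p.2) p := fun p => by
    fun_prop
  have hf : ∀ p : ℝ × ℝ, p.1 ∈ Icc s ε → DifferentiableAt ℝ f p := fun p hp =>
    ((hwγ p 0 hp).mul (differentiableAt_fst.mul (hsin p)).neg).add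
      ((hwγ p 1 hp).mul (differentiableAt_fst.mul (hcos p)))
  have hg : ∀ p : ℝ × ℝ, p.1 ∈ Icc s ε → DifferentiableAt ℝ g p := fun p hp =>
    (((hwγ p 0 hp).mul (hcos p)).add ((hwγ p 1 hp).mul (hsin p))).neg
  have hdiv : ∀ p : ℝ × ℝ, p.1 ∈ Icc s ε → fderiv ℝ f p (1, 0) + fderiv ℝ g p (0, 1) = 0 := by
    rintro ⟨r, t⟩ hp
    have hf1 := (hf (r, t) hp).hasFDerivAt.comp_hasDerivAt r
      ((hasDerivAt_id r).prodMk (hasDerivAt_const r t))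
    have hf2 := (((hasDerivAt_comp_circlePoint_radius (hwd (r, t) 0 hp)).mul
      ((hasDerivAt_id r).mul_const (Real.sin t)).neg).add
      ((hasDerivAt_comp_circlePoint_radius (hwd (r, t) 1 hp)).mul
      ((hasDerivAt_id r).mul_const (Real.cos t))))
    have hg1 := (hg (r, t) hp).hasFDerivAt.comp_hasDerivAt t
      ((hasDerivAt_const t r).prodMk (hasDerivAt_id t))
    have hg2 := (((hasDerivAt_comp_circlePoint_angle (hwd (r, t) 0 hp)).mul
      (Real.hasDerivAt_cos t)).add
      ((hasDerivAt_comp_circlePoint_angle (hwd (r, t) 1 hp)).mul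
      (Real.hasDerivAt_sin t))).neg
    rw [hf1.unique hf2, hg1.unique hg2]
    have hc := hcurl _ (hmem (r, t) hp)
    simp only [curl, id, Pi.neg_apply] at hc ⊢
    linear_combination r * (Real.cos t ^ 2 + Real.sin t ^ 2) * hc
  have hcf : ∀ u : Set ℝ, ContinuousOn f (uIcc s ε ×ˢ u) := fun u p hp =>
    (hf p (uIcc_of_le hsε ▸ hp.1)).continuousAt.continuousWithinAt
  have hcg : ∀ u : Set ℝ, ContinuousOn g (uIcc s ε ×ˢ u) := fun u p hp =>
    (hg p (uIcc_of_le hsε ▸ hp.1)).continuousAt.continuousWithinAt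
  have hIoo : ∀ r ∈ Ioo (min s ε) (max s ε), r ∈ Icc s ε := fun r hr => by
    rw [min_eq_left hsε, max_eq_right hsε] at hr
    exact Ioo_subset_Icc_self hr
  have key := integral2_divergence_prod_of_hasFDerivAt f g (fderiv ℝ f) (fderiv ℝ g)
    s 0 ε (2 * Real.pi) (hcf _) (hcg _) (fun p hp => (hf p (hIoo _ hp.1)).hasFDerivAt)
    (fun p hp => (hg p (hIoo _ hp.1)).hasFDerivAt) ?_
  · have h0 : (∫ r in s..ε, ∫ t in (0 : ℝ)..(2 * Real.pi),
        fderiv ℝ f (r, t) (1, 0) + fderiv ℝ g (r, t) (0, 1)) = 0 := by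
      rw [intervalIntegral.integral_congr (g := fun _ => (0 : ℝ))]
      · simp
      · intro r hr
        rw [uIcc_of_le hsε] at hr
        simp only [hdiv (r, _) hr, intervalIntegral.integral_zero]
    have hper : ∀ r, g (r, 2 * Real.pi) = g (r, 0) := fun r => by
      simp [g, circlePoint]
    rw [h0] at key
    simp only [hper, sub_self, zero_add] at key
    have hl : ∀ r, loopIntegral w r = ∫ t in (0 : ℝ)..(2 * Real.pi), f (r, t) := fun r => by
      simp [loopIntegral, f, circleVelocity, Fin.sum_univ_two]
    rw [hl, hl]
    linarith
  · refine (integrableOn_zero (ε' := ℝ)).congr_fun (fun p hp => ?_)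
      (measurableSet_uIcc.prod measurableSet_uIcc)
    rw [uIcc_of_le hsε] at hp
    exact (hdiv p hp.1).symm

theorem integral_plane_eq_integral_polar (F : Plane → ℝ) :
    ∫ y, F y = ∫ p in Ioi (0 : ℝ) ×ˢ Ioo (-Real.pi) Real.pi, p.1 * F (circlePoint p.1 p.2) := by
  have h1 := (Complex.orthonormalBasisOneI.repr.measurePreserving).integral_comp
    Complex.orthonormalBasisOneI.repr.toHomeomorph.measurableEmbedding F
  rw [← h1, ← Complex.integral_comp_polarCoord_symm]
  refine setIntegral_congr_fun (measurableSet_Ioi.prod measurableSet_Ioo) fun p _ => ?_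
  have : Complex.orthonormalBasisOneI.repr (Complex.polarCoord.symm p) = circlePoint p.1 p.2 := by
    ext i
    fin_cases i <;> simp [Complex.polarCoord_symm_apply, circlePoint,
      Complex.cos_ofReal_re, Complex.sin_ofReal_re]
  simp only [this, smul_eq_mul]

theorem fderiv_comp_norm_sq {η : ℝ → ℝ} (hη : ContDiff ℝ ∞ η) (y : Plane) (i : Fin 2) :
    fderiv ℝ (fun y : Plane => η (‖y‖ ^ 2)) y (e i) = deriv η (‖y‖ ^ 2) * (2 * y i) := by
  have h1 := (hη.differentiable (by simp) (‖y‖ ^ 2)).hasDerivAt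
  have := h1.comp_hasFDerivAt y (hasStrictFDerivAt_norm_sq y).hasFDerivAt
  have h2 : (fun y : Plane => η (‖y‖ ^ 2)) = η ∘ fun y : Plane => ‖y‖ ^ 2 := rfl
  rw [h2, this.fderiv]
  simp [e, EuclideanSpace.inner_single_right]

/-- A loop integral of a closed one-form as an integral over the plane against the gradient of a
radial cutoff function. -/
theorem integral_cutoff_eq_neg_loopIntegral {Ω : Opens Plane} {w : Fin 2 → Plane → ℝ}
    (hw : ∀ j, ContDiffOn ℝ ∞ (w j) (puncture Ω : Set Plane))
    (hcurl : ∀ y ∈ puncture Ω, curl w y = 0) {ε : ℝ} (hε : 0 < ε)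
    (hball : Metric.closedBall (0 : Plane) ε ⊆ Ω) {η : ℝ → ℝ} (hη : ContDiff ℝ ∞ η)
    {a : ℝ} (ha : 0 < a) (h1 : ∀ x ≤ a, η x = 1) (h0 : ∀ x, ε ^ 2 ≤ x → η x = 0)
    {χ : 𝓓(Ω, ℝ)} (hχ : ∀ y, χ y = η (‖y‖ ^ 2)) :
    ∫ y, (w 1 y * (∂_{e 0} χ : 𝓓(Ω, ℝ)) y - w 0 y * (∂_{e 1} χ : 𝓓(Ω, ℝ)) y)
      = -loopIntegral w ε := by
  have hχ' : (χ : Plane → ℝ) = fun y => η (‖y‖ ^ 2) := funext hχ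
  have hd : ∀ (i : Fin 2) (y : Plane),
      (∂_{e i} χ : 𝓓(Ω, ℝ)) y = deriv η (‖y‖ ^ 2) * (2 * y i) := fun i y => by
    rw [lineDeriv_testFunction_apply, hχ', fderiv_comp_norm_sq hη]
  have hd0 : ∀ x, ε ^ 2 < x → deriv η x = 0 := fun x hx => by
    have : η =ᶠ[𝓝 x] fun _ => 0 := by
      filter_upwards [lt_mem_nhds hx] with z hz
      exact h0 z hz.le
    rw [this.deriv_eq, deriv_const]
  have hd1 : ∀ i, ((∂_{e i} χ : 𝓓(Ω, ℝ)) : Plane → ℝ) =ᶠ[𝓝 0] 0 := fun i => by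
    have hn : Tendsto (fun y : Plane => ‖y‖ ^ 2) (𝓝 0) (𝓝 0) := by
      have : Continuous fun y : Plane => ‖y‖ ^ 2 := by fun_prop
      simpa using this.tendsto 0
    filter_upwards [hn.eventually (gt_mem_nhds ha)] with y hy
    have : η =ᶠ[𝓝 (‖y‖ ^ 2)] fun _ => 1 := by
      filter_upwards [gt_mem_nhds hy] with z hz
      exact h1 z hz.le
    rw [hd, this.deriv_eq, deriv_const]
    simp
  set F : Plane → ℝ := fun y =>
    w 1 y * (∂_{e 0} χ : 𝓓(Ω, ℝ)) y - w 0 y * (∂_{e 1} χ : 𝓓(Ω, ℝ)) y with hF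
  have hFc : Continuous F := ((contDiff_mul_testFunction (hw 1) (hd1 0)).sub
    (contDiff_mul_testFunction (hw 0) (hd1 1))).continuous
  have hFp : ∀ s t, s * F (circlePoint s t) = 2 * s * deriv η (s ^ 2) *
      ∑ j, w j (circlePoint s t) * circleVelocity s t j := fun s t => by
    simp only [hF, hd, norm_circlePoint_sq, Fin.sum_univ_two]
    simp [circlePoint, circleVelocity]
    ring
  have hGc : Continuous fun p : ℝ × ℝ => p.1 * F (circlePoint p.1 p.2) :=
    continuous_fst.mul (hFc.comp contDiff_circlePoint.continuous)
  have hGi : IntegrableOn (fun p : ℝ × ℝ => p.1 * F (circlePoint p.1 p.2))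
      (Ioi (0 : ℝ) ×ˢ Ioo (-Real.pi) Real.pi) := by
    refine (hGc.continuousOn.integrableOn_compact
      (isCompact_Icc.prod isCompact_Icc :
        IsCompact (Icc (0 : ℝ) ε ×ˢ Icc (-Real.pi) Real.pi))).of_forall_sdiff_eq_zero
      (measurableSet_Ioi.prod measurableSet_Ioo) ?_
    rintro ⟨s, t⟩ ⟨⟨hs, ht⟩, hn⟩
    have hsε : ε < s := by
      by_contra! hle
      exact hn ⟨⟨(mem_Ioi.1 hs).le, hle⟩, Ioo_subset_Icc_self ht⟩
    simp only [hFp]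
    rw [hd0 _ (pow_lt_pow_left₀ hsε hε.le two_ne_zero)]
    simp
  have hinner : ∀ s ∈ Ioi (0 : ℝ), (∫ t in Ioo (-Real.pi) Real.pi, s * F (circlePoint s t))
      = 2 * s * deriv η (s ^ 2) * loopIntegral w ε := by
    intro s hs
    simp only [hFp]
    rw [integral_const_mul]
    rcases le_or_gt s ε with hle | hlt
    · congr 1
      rw [← loopIntegral_eq_of_closed hw hcurl hball hs hle, loopIntegral,
        ← integral_Ioc_eq_integral_Ioo,
        ← intervalIntegral.integral_of_le (by linarith [Real.pi_pos])]
      have hper : Function.Periodic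
          (fun t => ∑ j, w j (circlePoint s t) * circleVelocity s t j) (2 * Real.pi) := by
        intro t
        simp [circlePoint, circleVelocity]
      have := hper.intervalIntegral_add_eq (-Real.pi) 0
      rw [zero_add, show -Real.pi + 2 * Real.pi = Real.pi by ring] at this
      exact this
    · rw [hd0 _ (pow_lt_pow_left₀ hlt hε.le two_ne_zero)]
      simp
  have hder : ∀ s : ℝ, HasDerivAt (fun s => η (s ^ 2)) (2 * s * deriv η (s ^ 2)) s := fun s => by
    have := (hη.differentiable (by simp) (s ^ 2)).hasDerivAt.comp s (hasDerivAt_pow 2 s)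
    refine this.congr_deriv ?_
    push_cast
    ring
  have hdc : Continuous fun s : ℝ => 2 * s * deriv η (s ^ 2) := by
    have : Continuous (deriv η) := hη.continuous_deriv (by simp)
    fun_prop
  have hdi : IntegrableOn (fun s : ℝ => 2 * s * deriv η (s ^ 2)) (Ioi 0) := by
    refine (hdc.continuousOn.integrableOn_compact
      (isCompact_Icc : IsCompact (Icc (0 : ℝ) ε))).of_forall_sdiff_eq_zero measurableSet_Ioi ?_
    rintro s ⟨hs, hn⟩
    have hsε : ε < s := by
      by_contra! hle
      exact hn ⟨(mem_Ioi.1 hs).le, hle⟩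
    simp [hd0 _ (pow_lt_pow_left₀ hsε hε.le two_ne_zero)]
  have hlim : Tendsto (fun s : ℝ => η (s ^ 2)) atTop (𝓝 0) := by
    refine tendsto_const_nhds.congr' ?_
    filter_upwards [eventually_ge_atTop ε] with s hs
    exact (h0 _ (pow_le_pow_left₀ hε.le hs 2)).symm
  have hone := integral_Ioi_of_hasDerivAt_of_tendsto (hder 0).continuousAt.continuousWithinAt
    (fun s _ => hder s) hdi hlim
  rw [integral_plane_eq_integral_polar, Measure.volume_eq_prod, setIntegral_prod _ hGi,
    setIntegral_congr_fun measurableSet_Ioi hinner, integral_mul_const, hone]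
  simp [h1 0 ha.le]

/-! ### Hadamard's lemma -/

theorem hasFDerivAt_integral_dilation {f : Plane → ℝ} (hf : ContDiff ℝ ∞ f) (k : ℕ) (y : Plane) :
    HasFDerivAt (fun y : Plane => ∫ t in (0 : ℝ)..1, t ^ k * f (t • y))
      (∫ t in (0 : ℝ)..1, t ^ (k + 1) • fderiv ℝ f (t • y)) y := by
  have hf' : Continuous (fderiv ℝ f) := hf.continuous_fderiv (by simp)
  obtain ⟨C, hC⟩ := (isCompact_closedBall (0 : Plane) (‖y‖ + 1)).exists_bound_of_continuousOn
    hf'.continuousOn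
  refine intervalIntegral.hasFDerivAt_integral_of_dominated_of_fderiv_le
    (F' := fun (y : Plane) (t : ℝ) => t ^ (k + 1) • fderiv ℝ f (t • y)) (bound := fun _ => C)
    (Metric.ball_mem_nhds y one_pos) ?_ ?_ ?_ ?_ intervalIntegrable_const ?_
  · refine Eventually.of_forall fun x => Continuous.aestronglyMeasurable ?_
    have := hf.continuous
    fun_prop
  · refine Continuous.intervalIntegrable ?_ _ _
    have := hf.continuous
    fun_prop
  · refine Continuous.aestronglyMeasurable ?_
    fun_prop
  · refine ae_of_all _ fun t ht x hx => ?_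
    rw [uIoc_of_le zero_le_one] at ht
    have hx' : ‖x‖ < ‖y‖ + 1 := by
      have := norm_le_norm_add_norm_sub' x y
      rw [mem_ball_iff_norm] at hx
      linarith
    have htx : t • x ∈ Metric.closedBall (0 : Plane) (‖y‖ + 1) := by
      rw [mem_closedBall_zero_iff, norm_smul, Real.norm_of_nonneg ht.1.le]
      exact (mul_le_of_le_one_left (norm_nonneg x) ht.2).trans hx'.le
    rw [norm_smul, norm_pow, Real.norm_of_nonneg ht.1.le]
    exact (mul_le_of_le_one_left (norm_nonneg _) (pow_le_one₀ ht.1.le ht.2)).trans (hC _ htx)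
  · refine ae_of_all _ fun t _ x _ => ?_
    have h1 : HasFDerivAt f (fderiv ℝ f (t • x)) (t • x) :=
      (hf.differentiable (by simp) _).hasFDerivAt
    have h2 := (h1.comp x ((hasFDerivAt_id x).const_smul t)).const_mul (t ^ k)
    refine h2.congr_fderiv ?_
    ext v
    simp
    ring

/-- The weight `t ^ k` is what differentiating under the integral sign produces, so that the
induction on the order of differentiability closes. -/
theorem contDiff_integral_dilation {f : Plane → ℝ} (hf : ContDiff ℝ ∞ f) (k : ℕ) :
    ContDiff ℝ ∞ fun y : Plane => ∫ t in (0 : ℝ)..1, t ^ k * f (t • y) := by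
  refine contDiff_infty.2 fun n => ?_
  induction n generalizing f k with
  | zero =>
    exact contDiff_zero.2 (continuous_iff_continuousAt.2 fun y =>
      (hasFDerivAt_integral_dilation hf k y).continuousAt)
  | succ n ih =>
    rw [Nat.cast_succ, contDiff_succ_iff_fderiv_apply]
    refine ⟨fun y => (hasFDerivAt_integral_dilation hf k y).differentiableAt, by simp, fun v => ?_⟩
    have hv : ContDiff ℝ ∞ fun x => fderiv ℝ f x v :=
      (hf.fderiv_right (by simp)).clm_apply contDiff_const
    convert ih hv (k + 1) using 2 with y
    rw [(hasFDerivAt_integral_dilation hf k y).fderiv, ContinuousLinearMap.intervalIntegral_apply]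
    · rfl
    · refine Continuous.intervalIntegrable ?_ _ _
      have hf' : Continuous (fderiv ℝ f) := hf.continuous_fderiv (by simp)
      fun_prop

theorem eq_smul_e_add (y : Plane) : y = y 0 • e 0 + y 1 • e 1 := by
  ext i
  fin_cases i <;> simp [e_apply]

/-- Hadamard's lemma in the plane. -/
theorem exists_eq_add_coord_mul {g : Plane → ℝ} (hg : ContDiff ℝ ∞ g) :
    ∃ h : Fin 2 → Plane → ℝ, (∀ i, ContDiff ℝ ∞ (h i)) ∧
      ∀ y, g y = g 0 + y 0 * h 0 y + y 1 * h 1 y := by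
  have hv : ∀ i : Fin 2, ContDiff ℝ ∞ fun x => fderiv ℝ g x (e i) := fun i =>
    (hg.fderiv_right (by simp)).clm_apply contDiff_const
  refine ⟨fun i y => ∫ t in (0 : ℝ)..1, t ^ 0 * fderiv ℝ g (t • y) (e i),
    fun i => contDiff_integral_dilation (hv i) 0, fun y => ?_⟩
  have hc : ∀ i : Fin 2, Continuous fun t : ℝ => fderiv ℝ g (t • y) (e i) := fun i =>
    (hv i).continuous.comp (continuous_id.smul continuous_const)
  have hd : ∀ t : ℝ, HasDerivAt (fun t : ℝ => g (t • y))
      (y 0 * fderiv ℝ g (t • y) (e 0) + y 1 * fderiv ℝ g (t • y) (e 1)) t := fun t => by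
    have h1 := (hg.differentiable (by simp) (t • y)).hasFDerivAt.comp_hasDerivAt t
      ((hasDerivAt_id t).smul_const y)
    refine h1.congr_deriv ?_
    rw [one_smul]
    refine (congrArg (fderiv ℝ g (t • y)) (eq_smul_e_add y)).trans ?_
    rw [map_add, map_smul, map_smul, smul_eq_mul, smul_eq_mul]
  have := intervalIntegral.integral_eq_sub_of_hasDerivAt (a := 0) (b := 1) (fun t _ => hd t)
    ((((hc 0).const_mul _).add ((hc 1).const_mul _)).intervalIntegrable _ _)
  rw [intervalIntegral.integral_add (((hc 0).const_mul _).intervalIntegrable _ _)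
    (((hc 1).const_mul _).intervalIntegrable _ _), intervalIntegral.integral_const_mul,
    intervalIntegral.integral_const_mul, one_smul, zero_smul] at this
  simp only [pow_zero, one_mul]
  linarith

/-! ### Distributions supported at a point -/

/-- On the test functions supported in a fixed compact set, a distribution has finite order. -/
theorem exists_order_bound {Ω : Opens Plane} (T : 𝓓'(Ω, ℝ)) {K : Set Plane} (hK : IsCompact K)
    (hKΩ : K ⊆ Ω) : ∃ (m : ℕ) (C : ℝ), ∀ φ : 𝓓(Ω, ℝ), tsupport φ ⊆ K → ∀ B : ℝ, 0 ≤ B →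
      (∀ n ≤ m, ∀ x ∈ K, ‖iteratedFDeriv ℝ n φ x‖ ≤ B) → |T φ| ≤ C * B := by
  let K' : Compacts Plane := ⟨K, hK⟩
  let L : 𝓓^{⊤}_{K'}(Plane, ℝ) →ₗ[ℝ] ℝ :=
    { toFun := fun φ => T (TestFunction.ofSupportedInCLM ℝ (K := K') hKΩ φ)
      map_add' := fun φ ψ => by rw [map_add, map_add]
      map_smul' := fun c φ => by rw [map_smul, map_smul]; rfl }
  have hL : Continuous L := T.continuous.comp (TestFunction.ofSupportedInCLM ℝ hKΩ).continuous
  obtain ⟨s, C, -, hC⟩ := Seminorm.bound_of_continuous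
    (ContDiffMapSupportedIn.withSeminorms ℝ Plane ℝ ⊤ K') ((normSeminorm ℝ ℝ).comp L)
    (hL.norm)
  refine ⟨s.sup id, C, fun φ hφ B hB h => ?_⟩
  let ψ : 𝓓^{⊤}_{K'}(Plane, ℝ) := .of_support_subset φ.contDiff ((subset_tsupport φ).trans hφ)
  have hψ : |T φ| ≤ C * (s.sup (ContDiffMapSupportedIn.seminorm ℝ Plane ℝ ⊤ K')) ψ := hC ψ
  refine hψ.trans (mul_le_mul_of_nonneg_left ?_ C.2)
  refine Seminorm.finset_sup_apply_le hB fun n hn => ?_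
  rw [ContDiffMapSupportedIn.seminorm_top_le_iff ℝ hB]
  exact h n (Finset.le_sup (f := id) hn)

theorem contDiff_coord (i : Fin 2) : ContDiff ℝ ∞ fun y : Plane => y i :=
  (EuclideanSpace.proj i : Plane →L[ℝ] ℝ).contDiff

/-- The product of `y₁ᵃ y₂ᵇ`, a smooth function `g` and a test function `χ`. -/
def monomialMul {U : Opens Plane} (a b : ℕ) (g : Plane → ℝ) (hg : ContDiff ℝ ∞ g) (χ : 𝓓(U, ℝ)) :
    𝓓(U, ℝ) :=
  smoothMul (fun y => y 0 ^ a * y 1 ^ b * g y)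
    ((((contDiff_coord 0).pow a).mul ((contDiff_coord 1).pow b)).mul hg) χ

theorem monomialMul_apply {U : Opens Plane} (a b : ℕ) (g : Plane → ℝ) (hg : ContDiff ℝ ∞ g)
    (χ : 𝓓(U, ℝ)) (y : Plane) : monomialMul a b g hg χ y = y 0 ^ a * y 1 ^ b * g y * χ y := rfl

section PointSupport

variable {r : ℝ} {T : 𝓓'(ballO r, ℝ)} {χ : 𝓓(ballO r, ℝ)}

theorem eventually_comp_inv_smul {l : ℝ} {P : Plane → Prop}
    (h : ∀ᶠ y in 𝓝 0, P y) : ∀ᶠ y in 𝓝 0, P (l⁻¹ • y) := by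
  have : Tendsto (fun y : Plane => l⁻¹ • y) (𝓝 0) (𝓝 0) := by
    simpa using (continuous_const_smul l⁻¹ : Continuous fun y : Plane => l⁻¹ • y).tendsto 0
  exact this.eventually h

/-- Shrinking the cutoff in `y₁ᵃ y₂ᵇ g χ` does not change the value of a distribution supported at
the origin, and by homogeneity it amounts to rescaling `y₁ᵃ y₂ᵇ χ`. -/
theorem apply_monomialMul_eq_rescale (hT : IsSupportedAtOrigin T)
    (hχ : ∀ᶠ y in 𝓝 0, χ y = 1) (a b : ℕ) {g : Plane → ℝ} (hg : ContDiff ℝ ∞ g) {l : ℝ}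
    (hl : 0 < l) (hl1 : l ≤ 1) :
    T (monomialMul a b g hg χ) = l ^ (a + b) * T (smoothMul g hg
      (l ^ 2 • rescale l (monomialMul a b (fun _ => 1) contDiff_const χ))) := by
  rw [← smul_eq_mul, ← map_smul]
  refine hT.congr ?_
  filter_upwards [hχ, eventually_comp_inv_smul (l := l) hχ] with y hy hy'
  change y 0 ^ a * y 1 ^ b * g y * χ y = l ^ (a + b) * (g y * (l ^ 2 *
    rescale l (monomialMul a b (fun _ => 1) contDiff_const χ) y))
  rw [rescale_apply hl hl1, monomialMul_apply, hy, hy']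
  have := hl.ne'
  simp only [PiLp.smul_apply, smul_eq_mul, mul_pow, pow_add, inv_pow]
  field_simp

/-- By homogeneity the value at `y₁ᵃ y₂ᵇ χ` equals `l ^ (a + b + 2 - k)` times a quantity tending
to zero as `l → 0⁺`. -/
theorem apply_monomialMul_eq_zero_of_scaling (hT : IsSupportedAtOrigin T)
    (hχ : ∀ᶠ y in 𝓝 0, χ y = 1) {k : ℝ}
    (hk : ∀ φ : 𝓓(ballO r, ℝ), Tendsto (fun l : ℝ => l ^ k * T (rescale l φ)) (𝓝[>] 0) (𝓝 0))
    {a b : ℕ} (hab : k < a + b + 2) :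
    T (monomialMul a b (fun _ => 1) contDiff_const χ) = 0 := by
  set ρ := monomialMul a b (fun _ => 1) contDiff_const χ with hρ
  have hexp : Tendsto (fun l : ℝ => l ^ ((a : ℝ) + b + 2 - k)) (𝓝[>] 0) (𝓝 0) := by
    have := (Real.continuousAt_rpow_const 0 ((a : ℝ) + b + 2 - k) (Or.inr (by linarith))).tendsto
    rw [Real.zero_rpow (by linarith)] at this
    exact this.mono_left nhdsWithin_le_nhds
  have hlim := hexp.mul (hk ρ)
  rw [mul_zero] at hlim
  refine tendsto_nhds_unique (tendsto_const_nhds.congr' ?_) hlim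
  filter_upwards [Ioc_mem_nhdsGT (zero_lt_one' ℝ)] with l hl
  have h1 := apply_monomialMul_eq_rescale hT hχ a b (contDiff_const (c := (1 : ℝ))) hl.1 hl.2
  have h2 : smoothMul (fun _ => (1 : ℝ)) contDiff_const (l ^ 2 • rescale l ρ)
      = l ^ 2 • rescale l ρ := by
    ext y
    rw [smoothMul_apply, one_mul]
  rw [h1, ← hρ, h2, map_smul, smul_eq_mul, ← mul_assoc, ← mul_assoc, ← Real.rpow_add hl.1,
    sub_add_cancel, ← pow_add, ← Real.rpow_natCast]
  push_cast
  rfl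

/-- A distribution of order `m` supported at the origin kills the functions that vanish there to
order greater than `m`. -/
theorem exists_forall_apply_monomialMul_eq_zero (hT : IsSupportedAtOrigin T)
    (hχ : ∀ᶠ y in 𝓝 0, χ y = 1) {r' : ℝ} (hr' : r' < r) (hχ' : ∀ y, r' ≤ ‖y‖ → χ y = 0) :
    ∃ m : ℕ, ∀ a b : ℕ, m < a + b → ∀ (g : Plane → ℝ) (hg : ContDiff ℝ ∞ g),
      T (monomialMul a b g hg χ) = 0 := by
  set K := Metric.closedBall (0 : Plane) r' with hKdef
  have hK : IsCompact K := isCompact_closedBall _ _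
  obtain ⟨m, C, hC⟩ := exists_order_bound T hK
    (Metric.closedBall_subset_ball hr' : K ⊆ (ballO r : Set Plane))
  refine ⟨m, fun a b hab g hg => ?_⟩
  set ρ : 𝓓(ballO r, ℝ) := monomialMul a b (fun _ => 1) contDiff_const χ with hρ
  have hρb : ∃ D, ∀ n ≤ m, ∀ x, ‖iteratedFDeriv ℝ n ρ x‖ ≤ D := by
    have : ∀ n, ∃ D, ∀ x, ‖iteratedFDeriv ℝ n ρ x‖ ≤ D := fun n =>
      Continuous.bounded_above_of_compact_support
        (ρ.contDiff.continuous_iteratedFDeriv (by exact_mod_cast le_top))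
        (ρ.hasCompactSupport.iteratedFDeriv n)
    choose D hD using this
    exact ⟨∑ n ∈ Finset.range (m + 1), D n, fun n hn x => (hD n x).trans
      (Finset.single_le_sum (fun i _ => (norm_nonneg _).trans (hD i x))
        (Finset.mem_range.2 (Nat.lt_succ_of_le hn)))⟩
  have hgb : ∃ D, 0 ≤ D ∧ ∀ n ≤ m, ∀ x ∈ K, ‖iteratedFDeriv ℝ n g x‖ ≤ D := by
    have : ∀ n, ∃ D, ∀ x ∈ K, ‖iteratedFDeriv ℝ n g x‖ ≤ D := fun n =>
      hK.exists_bound_of_continuousOn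
        (hg.continuous_iteratedFDeriv (by exact_mod_cast le_top)).continuousOn
    choose D hD using this
    refine ⟨∑ n ∈ Finset.range (m + 1), |D n|, by positivity, fun n hn x hx =>
      ((hD n x hx).trans (le_abs_self _)).trans
      (Finset.single_le_sum (f := fun n => |D n|) (fun i _ => abs_nonneg _)
        (Finset.mem_range.2 (Nat.lt_succ_of_le hn)))⟩
  obtain ⟨Dρ, hDρ⟩ := hρb
  obtain ⟨Dg, hDg0, hDg⟩ := hgb
  have hDρ0 : 0 ≤ Dρ := (norm_nonneg _).trans (hDρ 0 (Nat.zero_le _) 0)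
  -- With the cutoff shrunk by `l`, each of the at most `m` derivatives costs a factor `l⁻¹`,
  -- against the factor `l ^ (a + b)` from homogeneity.
  have key : ∀ l : ℝ, 0 < l → l ≤ 1 →
      |T (monomialMul a b g hg χ)| ≤ |C| * (2 ^ m * Dρ * Dg) * l := by
    intro l hl hl1
    set ψ : 𝓓(ballO r, ℝ) := smoothMul g hg (l ^ 2 • rescale l ρ) with hψ
    have hψv : (ψ : Plane → ℝ) = fun y => g y * ρ (l⁻¹ • y) := by
      ext y
      change g y * (l ^ 2 * rescale l ρ y) = _
      rw [rescale_apply hl hl1]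
      have := hl.ne'
      field_simp
    have hψs : tsupport ψ ⊆ K := by
      refine closure_minimal (fun y hy => ?_) Metric.isClosed_closedBall
      rw [hKdef, mem_closedBall_zero_iff]
      by_contra! hlt
      refine hy ?_
      have : χ (l⁻¹ • y) = 0 := by
        refine hχ' _ (hlt.le.trans ?_)
        rw [norm_smul, norm_inv, Real.norm_of_nonneg hl.le]
        exact le_mul_of_one_le_left (norm_nonneg y) ((one_le_inv₀ hl).2 hl1)
      rw [hψv]
      simp only [hρ, monomialMul_apply, this, mul_zero]
    have hb := hC ψ hψs ((l ^ m)⁻¹ * (2 ^ m * Dρ * Dg)) (by positivity) ?_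
    · rw [apply_monomialMul_eq_rescale hT hχ a b hg hl hl1, abs_mul,
        abs_of_pos (pow_pos hl _)]
      have h1 : l ^ (a + b) ≤ l ^ (m + 1) := pow_le_pow_of_le_one hl.le hl1 hab
      have h2 : |T ψ| ≤ |C| * ((l ^ m)⁻¹ * (2 ^ m * Dρ * Dg)) :=
        hb.trans (mul_le_mul_of_nonneg_right (le_abs_self C) (by positivity))
      refine (mul_le_mul h1 h2 (abs_nonneg _) (by positivity)).trans_eq ?_
      have := hl.ne'
      field_simp
      ring
    · intro n hn x hx
      have hρc : ContDiff ℝ ∞ fun y : Plane => ρ (l⁻¹ • y) :=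
        ρ.contDiff.comp (contDiff_const_smul _)
      rw [hψv]
      refine (norm_iteratedFDeriv_mul_le hg hρc x (n := n) (by exact_mod_cast le_top)).trans ?_
      have hterm : ∀ i ∈ Finset.range (n + 1),
          (n.choose i : ℝ) * ‖iteratedFDeriv ℝ i g x‖ *
            ‖iteratedFDeriv ℝ (n - i) (fun y : Plane => ρ (l⁻¹ • y)) x‖
          ≤ (n.choose i : ℝ) * Dg * ((l ^ m)⁻¹ * Dρ) := by
        intro i hi
        have hi' : i ≤ n := Nat.lt_succ_iff.1 (Finset.mem_range.1 hi)
        refine mul_le_mul (mul_le_mul_of_nonneg_left (hDg i (hi'.trans hn) x hx)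
          (Nat.cast_nonneg _)) ?_ (norm_nonneg _) (by positivity)
        rw [iteratedFDeriv_comp_const_smul l⁻¹ (contDiff_infty.1 ρ.contDiff _),
          norm_smul, norm_pow, norm_inv, Real.norm_of_nonneg hl.le, ← inv_pow]
        refine mul_le_mul ?_ (hDρ _ ((Nat.sub_le _ _).trans hn) _) (norm_nonneg _) (by positivity)
        exact pow_le_pow_right₀ ((one_le_inv₀ hl).2 hl1) ((Nat.sub_le _ _).trans hn)
      refine (Finset.sum_le_sum hterm).trans ?_
      rw [← Finset.sum_mul, ← Finset.sum_mul]
      have hsum : (∑ i ∈ Finset.range (n + 1), (n.choose i : ℝ)) ≤ 2 ^ m := by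
        have : (∑ i ∈ Finset.range (n + 1), (n.choose i : ℝ)) = 2 ^ n := by
          exact_mod_cast Nat.sum_range_choose n
        rw [this]
        exact pow_le_pow_right₀ one_le_two hn
      calc _ ≤ 2 ^ m * Dg * ((l ^ m)⁻¹ * Dρ) := by gcongr
        _ = _ := by ring
  have hlim : Tendsto (fun l : ℝ => |C| * (2 ^ m * Dρ * Dg) * l) (𝓝[>] 0) (𝓝 0) := by
    have : Continuous fun l : ℝ => |C| * (2 ^ m * Dρ * Dg) * l := by fun_prop
    have h := this.tendsto 0
    rw [mul_zero] at h
    exact h.mono_left nhdsWithin_le_nhds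
  have h0 : |T (monomialMul a b g hg χ)| ≤ 0 := by
    refine ge_of_tendsto hlim ?_
    filter_upwards [Ioc_mem_nhdsGT (zero_lt_one' ℝ)] with l hl using key l hl.1 hl.2
  exact abs_nonpos_iff.1 h0

/-- Hadamard's lemma inside the pairing with a distribution. -/
theorem exists_apply_monomialMul_eq (T : 𝓓'(ballO r, ℝ)) (χ : 𝓓(ballO r, ℝ)) (a b : ℕ)
    {g : Plane → ℝ} (hg : ContDiff ℝ ∞ g) :
    ∃ (h₀ h₁ : Plane → ℝ) (hh₀ : ContDiff ℝ ∞ h₀) (hh₁ : ContDiff ℝ ∞ h₁),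
      T (monomialMul a b g hg χ) = g 0 * T (monomialMul a b (fun _ => 1) contDiff_const χ)
        + T (monomialMul (a + 1) b h₀ hh₀ χ) + T (monomialMul a (b + 1) h₁ hh₁ χ) := by
  obtain ⟨h, hh, hgh⟩ := exists_eq_add_coord_mul hg
  refine ⟨h 0, h 1, hh 0, hh 1, ?_⟩
  rw [← smul_eq_mul, ← map_smul, ← map_add, ← map_add]
  congr 1
  ext y
  change y 0 ^ a * y 1 ^ b * g y * χ y = g 0 * (y 0 ^ a * y 1 ^ b * 1 * χ y)
    + y 0 ^ (a + 1) * y 1 ^ b * h 0 y * χ y + y 0 ^ a * y 1 ^ (b + 1) * h 1 y * χ y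
  rw [hgh y]
  ring

/-- A distribution supported at the origin whose scaling degree is less than `4` is a combination
of `δ_O` and its first derivatives; it vanishes if its zeroth and first moments do. -/
theorem eq_zero_of_isSupportedAtOrigin (hT : IsSupportedAtOrigin T)
    (hχ : ∀ᶠ y in 𝓝 0, χ y = 1) {r' : ℝ} (hr' : r' < r) (hχ' : ∀ y, r' ≤ ‖y‖ → χ y = 0)
    {k : ℝ} (hk4 : k < 4)
    (hk : ∀ φ : 𝓓(ballO r, ℝ), Tendsto (fun l : ℝ => l ^ k * T (rescale l φ)) (𝓝[>] 0) (𝓝 0))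
    (h00 : T (monomialMul 0 0 (fun _ => 1) contDiff_const χ) = 0)
    (h10 : T (monomialMul 1 0 (fun _ => 1) contDiff_const χ) = 0)
    (h01 : T (monomialMul 0 1 (fun _ => 1) contDiff_const χ) = 0) : T = 0 := by
  obtain ⟨m, hm⟩ := exists_forall_apply_monomialMul_eq_zero hT hχ hr' hχ'
  -- Induction on the number `n` of orders still missing to exceed the order `m` of `T`.
  have hge2 : ∀ n a b : ℕ, 2 ≤ a + b → m < a + b + n → ∀ (g : Plane → ℝ) (hg : ContDiff ℝ ∞ g),
      T (monomialMul a b g hg χ) = 0 := by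
    intro n
    induction n with
    | zero => exact fun a b _ hmab => hm a b hmab
    | succ n ih =>
      intro a b hab hmab g hg
      obtain ⟨h₀, h₁, hh₀, hh₁, heq⟩ := exists_apply_monomialMul_eq T χ a b hg
      have hab' : (2 : ℝ) ≤ a + b := by exact_mod_cast hab
      rw [heq, apply_monomialMul_eq_zero_of_scaling hT hχ hk (by linarith),
        ih (a + 1) b (by omega) (by omega), ih a (b + 1) (by omega) (by omega)]
      ring
  have hge1 : ∀ a b : ℕ, a + b = 1 →
      T (monomialMul a b (fun _ => 1) contDiff_const χ) = 0 →
      ∀ (g : Plane → ℝ) (hg : ContDiff ℝ ∞ g), T (monomialMul a b g hg χ) = 0 := by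
    intro a b hab h0 g hg
    obtain ⟨h₀, h₁, hh₀, hh₁, heq⟩ := exists_apply_monomialMul_eq T χ a b hg
    rw [heq, h0, hge2 m (a + 1) b (by omega) (by omega), hge2 m a (b + 1) (by omega) (by omega)]
    ring
  ext φ
  obtain ⟨h₀, h₁, hh₀, hh₁, heq⟩ := exists_apply_monomialMul_eq T χ 0 0 φ.contDiff
  have hφ : T φ = T (monomialMul 0 0 φ φ.contDiff χ) := by
    refine hT.congr ?_
    filter_upwards [hχ] with y hy
    rw [monomialMul_apply, hy]
    simp
  change T φ = 0
  rw [hφ, heq, h00, hge1 1 0 rfl h10, hge1 0 1 rfl h01]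
  ring

end PointSupport

/-! ### Radial cutoff functions -/

/-- A smooth function of `x = ‖y‖²`, equal to `1` for `x ≤ ε² / 4` and to `0` for `ε² / 2 ≤ x`. -/
def cutoffProfile (ε x : ℝ) : ℝ := Real.smoothTransition (2 - 4 / ε ^ 2 * x)

theorem contDiff_cutoffProfile (ε : ℝ) : ContDiff ℝ ∞ (cutoffProfile ε) :=
  Real.smoothTransition.contDiff.comp (contDiff_const.sub (contDiff_const.mul contDiff_id))

theorem cutoffProfile_eq_one {ε : ℝ} (hε : 0 < ε) {x : ℝ} (hx : x ≤ ε ^ 2 / 4) :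
    cutoffProfile ε x = 1 := by
  refine Real.smoothTransition.one_of_one_le ?_
  have : 4 / ε ^ 2 * x ≤ 4 / ε ^ 2 * (ε ^ 2 / 4) := by gcongr
  have h1 : 4 / ε ^ 2 * (ε ^ 2 / 4) = 1 := by field_simp
  linarith

theorem cutoffProfile_eq_zero {ε : ℝ} (hε : 0 < ε) {x : ℝ} (hx : ε ^ 2 / 2 ≤ x) :
    cutoffProfile ε x = 0 := by
  refine Real.smoothTransition.zero_of_nonpos ?_
  have : 4 / ε ^ 2 * (ε ^ 2 / 2) ≤ 4 / ε ^ 2 * x := by gcongr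
  have h1 : 4 / ε ^ 2 * (ε ^ 2 / 2) = 2 := by
    field_simp
    norm_num
  linarith

theorem cutoffProfile_norm_sq_eq_zero {ε : ℝ} (hε : 0 < ε) {y : Plane} (hy : 3 / 4 * ε ≤ ‖y‖) :
    cutoffProfile ε (‖y‖ ^ 2) = 0 := by
  refine cutoffProfile_eq_zero hε ?_
  have := pow_le_pow_left₀ (by positivity) hy 2
  nlinarith [sq_nonneg ε]

/-- A radial cutoff function on `B_ε`, equal to `1` near `O`. -/
def cutoff {ε : ℝ} (hε : 0 < ε) : 𝓓(ballO ε, ℝ) :=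
  have hs : tsupport (fun y : Plane => cutoffProfile ε (‖y‖ ^ 2))
      ⊆ Metric.closedBall 0 (3 / 4 * ε) :=
    closure_minimal (fun y hy => by
      rw [mem_closedBall_zero_iff]
      by_contra! hlt
      exact hy (cutoffProfile_norm_sq_eq_zero hε hlt.le)) Metric.isClosed_closedBall
  { toFun := fun y => cutoffProfile ε (‖y‖ ^ 2)
    contDiff' := (contDiff_cutoffProfile ε).comp (contDiff_norm_sq ℝ)
    hasCompactSupport' := (isCompact_closedBall _ _).of_isClosed_subset (isClosed_tsupport _) hs
    tsupport_subset' := hs.trans (Metric.closedBall_subset_ball (by linarith)) }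

theorem eventually_cutoff_eq_one {ε : ℝ} (hε : 0 < ε) : ∀ᶠ y in 𝓝 0, cutoff hε y = 1 := by
  have hn : Tendsto (fun y : Plane => ‖y‖ ^ 2) (𝓝 0) (𝓝 0) := by
    have : Continuous fun y : Plane => ‖y‖ ^ 2 := by fun_prop
    simpa using this.tendsto 0
  filter_upwards [hn.eventually (gt_mem_nhds (by positivity : 0 < ε ^ 2 / 4))] with y hy
  exact cutoffProfile_eq_one hε hy.le

/-! ### The incompatibility tested against cut off infinitesimal rigid motions -/

theorem contDiff_crossE3_sub (x : Plane) (i : Fin 2) :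
    ContDiff ℝ ∞ fun y : Plane => crossE3 (y - x) i := by
  have h0 := contDiff_coord 0
  have h1 := contDiff_coord 1
  fin_cases i
  · exact h1.sub contDiff_const
  · exact (h0.sub contDiff_const).neg

theorem fderiv_crossE3_sub (x y v : Plane) (i : Fin 2) :
    fderiv ℝ (fun y : Plane => crossE3 (y - x) i) y v = crossE3 v i := by
  fin_cases i
  · have : (fun y : Plane => crossE3 (y - x) 0) = fun y => -x 1 + 0 * y 0 + 1 * y 1 := by
      ext y
      simp [crossE3]
      ring
    exact (congrArg (fun f => fderiv ℝ f y v) this).trans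
      ((fderiv_affine _ _ _ _ _).trans (by simp [crossE3]))
  · have : (fun y : Plane => crossE3 (y - x) 1) = fun y => x 0 + (-1) * y 0 + 0 * y 1 := by
      ext y
      simp [crossE3]
      ring
    exact (congrArg (fun f => fderiv ℝ f y v) this).trans
      ((fderiv_affine _ _ _ _ _).trans (by simp [crossE3]))

theorem lineDeriv_smoothMul_crossE3 {U : Opens Plane} (χ : 𝓓(U, ℝ)) (x v : Plane) (i : Fin 2) :
    (∂_{v} (smoothMul _ (contDiff_crossE3_sub x i) χ) : 𝓓(U, ℝ))
      = smoothMul _ (contDiff_crossE3_sub x i) (∂_{v} χ) + crossE3 v i • χ := by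
  ext y
  change _ = crossE3 (y - x) i * (∂_{v} χ : 𝓓(U, ℝ)) y + crossE3 v i * χ y
  rw [lineDeriv_testFunction_apply, lineDeriv_testFunction_apply]
  have h := (((contDiff_crossE3_sub x i).differentiable (by simp) y).hasFDerivAt).mul
    ((χ.contDiff.contDiffAt.differentiableAt (by simp) : DifferentiableAt ℝ χ y).hasFDerivAt)
  have h2 : (smoothMul _ (contDiff_crossE3_sub x i) χ : Plane → ℝ)
      = (fun y => crossE3 (y - x) i) * χ := rfl
  rw [h2, h.fderiv]
  simp only [add_apply, smul_apply, smul_eq_mul, fderiv_crossE3_sub]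
  ring

theorem curl_apply {Ω : Opens Plane} (v : Fin 2 → 𝓓'(Ω, ℝ)) (φ : 𝓓(Ω, ℝ)) :
    Curl v φ = -v 1 (∂_{e 0} φ) + v 0 (∂_{e 1} φ) := by
  change (∂_{e 0} (v 1) : 𝓓'(Ω, ℝ)) φ - (∂_{e 1} (v 0) : 𝓓'(Ω, ℝ)) φ = _
  rw [lineDeriv_distribution_apply, lineDeriv_distribution_apply, sub_neg_eq_add]

theorem HasDensityOffOrigin.curl {Ω : Opens Plane} {v : Fin 2 → 𝓓'(Ω, ℝ)}
    {f : Fin 2 → Plane → ℝ} (h : ∀ i, HasDensityOffOrigin (v i) (f i)) :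
    HasDensityOffOrigin (Curl v) (curl f) :=
  ((h 1).lineDeriv (e 0)).sub ((h 0).lineDeriv (e 1))

section Cesaro

variable {Ω : Opens Plane} {E : Matrix (Fin 2) (Fin 2) 𝓓'(Ω, ℝ)}
  {E₀ : Matrix (Fin 2) (Fin 2) (Plane → ℝ)}

theorem contDiffOn_cesaroKernel (hE : ∀ i j, HasDensityOffOrigin (E i j) (E₀ i j)) (x : Plane)
    (i j : Fin 2) :
    ContDiffOn ℝ ∞ (fun y => cesaroKernel E₀ x y i j) (puncture Ω : Set Plane) :=
  (hE i j).1.add ((contDiff_crossE3_sub x i).contDiffOn.mul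
    (HasDensityOffOrigin.curl (hE j)).1)

/-- The rows of the Cesàro kernel are closed one-forms where `curl curl E₀ = 0`. -/
theorem curl_cesaroKernel (hE : ∀ i j, HasDensityOffOrigin (E i j) (E₀ i j))
    (hcc : ∀ y ∈ puncture Ω, curl (fieldCurl E₀) y = 0) (x : Plane) (i : Fin 2) :
    ∀ y ∈ puncture Ω, curl (fun j y => cesaroKernel E₀ x y i j) y = 0 := by
  intro y hy
  have hnhds := (puncture Ω).isOpen.mem_nhds hy
  have hd : ∀ j v, fderiv ℝ (fun y => cesaroKernel E₀ x y i j) y v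
      = fderiv ℝ (E₀ i j) y v + (crossE3 (y - x) i * fderiv ℝ (fieldCurl E₀ j) y v
        + fieldCurl E₀ j y * crossE3 v i) := by
    intro j v
    have h1 := (((hE i j).1.contDiffAt hnhds).differentiableAt (by simp)).hasFDerivAt
    have h2 := (((HasDensityOffOrigin.curl (hE j)).1.contDiffAt hnhds).differentiableAt
      (by simp)).hasFDerivAt
    have h3 := ((contDiff_crossE3_sub x i).differentiable (by simp) y).hasFDerivAt
    have h4 : (fun y => cesaroKernel E₀ x y i j)
        = E₀ i j + (fun y => crossE3 (y - x) i) * curl (E₀ j) := rfl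
    rw [h4, (h1.add (h3.mul h2)).fderiv]
    simp only [add_apply, smul_apply, smul_eq_mul, fderiv_crossE3_sub]
    rfl
  have h := hcc y hy
  simp only [curl] at h ⊢
  rw [hd, hd]
  have hi : fieldCurl E₀ 1 y * crossE3 (e 0) i - fieldCurl E₀ 0 y * crossE3 (e 1) i
      = -fieldCurl E₀ i y := by
    fin_cases i <;> simp [crossE3, e_apply]
  have hf : fieldCurl E₀ i y = fderiv ℝ (E₀ i 1) y (e 0) - fderiv ℝ (E₀ i 0) y (e 1) := rfl
  linear_combination crossE3 (y - x) i * h + hi - hf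

/-- If `curl curl E₀ = 0` off the origin, the pairing of `Curl Curl E` with the `i`-th component
of `(y - x) × e₃`, cut off near `O`, is the `i`-th component of the Cesàro integral: integration by
parts leaves an integral over the region where the cutoff varies, and this is a loop integral of
the closed `i`-th row of the Cesàro kernel. -/
theorem curl_tensorCurl_apply_cutoff (hE : ∀ i j, HasDensityOffOrigin (E i j) (E₀ i j))
    (hcc : ∀ y ∈ puncture Ω, curl (fieldCurl E₀) y = 0) {ε : ℝ} (hε : 0 < ε)
    (hball : Metric.closedBall (0 : Plane) ε ⊆ Ω) (x : Plane) (i : Fin 2) {χ : 𝓓(Ω, ℝ)}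
    (hχ : ∀ y, χ y = cutoffProfile ε (‖y‖ ^ 2)) (hχ1 : ∀ᶠ y in 𝓝 0, χ y = 1) :
    Curl (tensorCurl E) (smoothMul _ (contDiff_crossE3_sub x i) χ) = cesaroIntegral E₀ ε x i := by
  have hC : ∀ j, HasDensityOffOrigin (tensorCurl E j) (fieldCurl E₀ j) := fun j =>
    HasDensityOffOrigin.curl (hE j)
  have hd : ∀ v, ((∂_{v} χ : 𝓓(Ω, ℝ)) : Plane → ℝ) =ᶠ[𝓝 0] 0 := fun v => by
    have : (χ : Plane → ℝ) =ᶠ[𝓝 0] fun y => 1 + 0 * y 0 + 0 * y 1 := by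
      filter_upwards [hχ1] with y hy
      rw [hy]
      ring
    filter_upwards [lineDeriv_eventuallyEq_const this v] with y hy
    rw [hy]
    simp
  have hq : ∀ v, (smoothMul _ (contDiff_crossE3_sub x i) (∂_{v} χ) : Plane → ℝ) =ᶠ[𝓝 0] 0 :=
    fun v => by
      filter_upwards [hd v] with y hy
      rw [smoothMul_apply, hy]
      simp
  -- The terms in which `χ` itself is not differentiated combine to `Curl` of the `i`-th row,
  -- which moves one more derivative onto `χ`.
  have hi : -(crossE3 (e 0) i * tensorCurl E 1 χ) + crossE3 (e 1) i * tensorCurl E 0 χ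
      = tensorCurl E i χ := by
    fin_cases i <;> simp [crossE3, e_apply]
  have hi' : tensorCurl E i χ = -E i 1 (∂_{e 0} χ) + E i 0 (∂_{e 1} χ) := curl_apply _ _
  have hloop : cesaroIntegral E₀ ε x i = loopIntegral (fun j y => cesaroKernel E₀ x y i j) ε := rfl
  rw [hloop, ← neg_neg (loopIntegral _ _), ← integral_cutoff_eq_neg_loopIntegral
    (contDiffOn_cesaroKernel hE x i) (curl_cesaroKernel hE hcc x i) hε hball
    (contDiff_cutoffProfile ε) (by positivity : 0 < ε ^ 2 / 4)
    (fun _ => cutoffProfile_eq_one hε)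
    (fun z hz => cutoffProfile_eq_zero hε (by linarith [sq_nonneg ε])) hχ]
  rw [curl_apply, lineDeriv_smoothMul_crossE3, lineDeriv_smoothMul_crossE3, map_add, map_add,
    map_smul, map_smul, smul_eq_mul, smul_eq_mul]
  have hsum : -(tensorCurl E 1 (smoothMul _ (contDiff_crossE3_sub x i) (∂_{e 0} χ))
        + crossE3 (e 0) i * tensorCurl E 1 χ)
      + (tensorCurl E 0 (smoothMul _ (contDiff_crossE3_sub x i) (∂_{e 1} χ))
        + crossE3 (e 1) i * tensorCurl E 0 χ)
      = -((E i 1 (∂_{e 0} χ) + tensorCurl E 1 (smoothMul _ (contDiff_crossE3_sub x i) (∂_{e 0} χ)))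
        - (E i 0 (∂_{e 1} χ)
          + tensorCurl E 0 (smoothMul _ (contDiff_crossE3_sub x i) (∂_{e 1} χ)))) := by
    linear_combination hi + hi'
  have hI1 := integrable_mul_testFunction (hE i 1).1 (hd (e 0))
  have hI0 := integrable_mul_testFunction (hE i 0).1 (hd (e 1))
  have hJ1 := integrable_mul_testFunction (hC 1).1 (hq (e 0))
  have hJ0 := integrable_mul_testFunction (hC 0).1 (hq (e 1))
  rw [hsum, (hE i 1).2 _ (hd _), (hE i 0).2 _ (hd _), (hC 1).2 _ (hq _), (hC 0).2 _ (hq _),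
    ← integral_add hI1 hJ1, ← integral_add hI0 hJ0,
    ← integral_sub (hI1.fun_add hJ1) (hI0.fun_add hJ0)]
  congr 2
  ext y
  simp only [cesaroKernel, smoothMul_apply]
  ring

theorem pointSupported_apply_cutoff (Ω : Opens Plane) (c : ℕ × ℕ →₀ ℝ) (x : Plane) (i : Fin 2)
    {χ : 𝓓(Ω, ℝ)} (hχ1 : ∀ᶠ y in 𝓝 0, χ y = 1) :
    pointSupported Ω c (smoothMul _ (contDiff_crossE3_sub x i) χ)
      = (-(c (0, 1)) • e 0 + c (1, 0) • e 1 + c (0, 0) • e3Cross x : Plane) i := by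
  fin_cases i
  · rw [pointSupported_apply_of_affine Ω c (a := -x 1) (b := 0) (d := 1)]
    · simp [e_apply, e3Cross]
      ring
    · filter_upwards [hχ1] with y hy
      rw [smoothMul_apply, hy]
      simp [crossE3]
      ring
  · rw [pointSupported_apply_of_affine Ω c (a := x 0) (b := -1) (d := 0)]
    · simp [e_apply, e3Cross]
      ring
    · filter_upwards [hχ1] with y hy
      rw [smoothMul_apply, hy]
      simp [crossE3]
      ring

end Cesaro

/-! ### Vanishing of the residual distribution -/

theorem isSupportedAtOrigin_of_density_eq_zero {Ω : Opens Plane} {T : 𝓓'(Ω, ℝ)} {f : Plane → ℝ}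
    (h : HasDensityOffOrigin T f) (hf : ∀ y ∈ puncture Ω, f y = 0) : IsSupportedAtOrigin T := by
  intro φ hφ
  rw [h.2 φ hφ]
  refine integral_eq_zero_of_ae (ae_of_all _ fun y => ?_)
  by_cases hy : y ∈ tsupport φ
  · simp [hf y (tsupport_subset_puncture hφ hy)]
  · simp [image_eq_zero_of_notMem_tsupport hy]

/-- A distribution supported at the origin with scaling degree less than `4` vanishes if it kills
all cut off functions `(y - x) × e₃`, `x ∈ Ω - O`. -/
theorem eq_zero_of_apply_cutoff_eq_zero {Ω : Opens Plane} {M : 𝓓'(Ω, ℝ)}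
    (hM : IsSupportedAtOrigin M) {k : ℝ} (hk4 : k < 4) (hk : ScalesToZero M k) {ε : ℝ}
    (hε : 0 < ε) (hball : Metric.closedBall (0 : Plane) ε ⊆ Ω)
    (hx : ∀ x ∈ puncture Ω, ∀ i, M (smoothMul _ (contDiff_crossE3_sub x i)
      (TestFunction.monoCLM ℝ (cutoff hε))) = 0) : M = 0 := by
  have hle : ballO ε ≤ Ω := Metric.ball_subset_closedBall.trans hball
  have hM' : IsSupportedAtOrigin (restrictTo (ballO ε) M) := fun φ hφ => by
    rw [restrictTo_apply]
    exact hM _ (by rwa [coe_monoCLM hle])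
  set m : ℕ → ℕ → ℝ := fun a b =>
    restrictTo (ballO ε) M (monomialMul a b (fun _ => 1) contDiff_const (cutoff hε)) with hm
  have hrow0 : ∀ x ∈ puncture Ω, m 0 1 - x 1 * m 0 0 = 0 := by
    intro x hxΩ
    rw [← hx x hxΩ 0]
    simp only [hm, restrictTo_apply]
    rw [← smul_eq_mul, ← map_smul, ← map_sub]
    congr 1
    ext y
    change (TestFunction.monoCLM ℝ (monomialMul 0 1 (fun _ => 1) contDiff_const (cutoff hε)) :
        𝓓(Ω, ℝ)) y
      - x 1 * (TestFunction.monoCLM ℝ (monomialMul 0 0 (fun _ => 1) contDiff_const (cutoff hε)) :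
        𝓓(Ω, ℝ)) y = crossE3 (y - x) 0 * (TestFunction.monoCLM ℝ (cutoff hε) : 𝓓(Ω, ℝ)) y
    rw [coe_monoCLM hle, coe_monoCLM hle, coe_monoCLM hle, monomialMul_apply, monomialMul_apply]
    simp [crossE3]
    ring
  have hrow1 : ∀ x ∈ puncture Ω, x 0 * m 0 0 - m 1 0 = 0 := by
    intro x hxΩ
    rw [← hx x hxΩ 1]
    simp only [hm, restrictTo_apply]
    rw [← smul_eq_mul, ← map_smul, ← map_sub]
    congr 1
    ext y
    change x 0 * (TestFunction.monoCLM ℝ (monomialMul 0 0 (fun _ => 1) contDiff_const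
        (cutoff hε)) : 𝓓(Ω, ℝ)) y
      - (TestFunction.monoCLM ℝ (monomialMul 1 0 (fun _ => 1) contDiff_const (cutoff hε)) :
        𝓓(Ω, ℝ)) y = crossE3 (y - x) 1 * (TestFunction.monoCLM ℝ (cutoff hε) : 𝓓(Ω, ℝ)) y
    rw [coe_monoCLM hle, coe_monoCLM hle, coe_monoCLM hle, monomialMul_apply, monomialMul_apply]
    simp [crossE3]
    ring
  -- The points `x = ε e₁` and `x = ε e₂` already determine the three moments.
  have hmem : ∀ i : Fin 2, ε • e i ∈ puncture Ω := by
    intro i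
    refine ⟨hball ?_, fun h => ?_⟩
    · simp [e, norm_smul, abs_of_pos hε]
    · have := congrArg (fun y : Plane => y i) (mem_singleton_iff.1 h)
      simp [e_apply, hε.ne'] at this
  have h01 : m 0 1 = 0 := by simpa [e_apply] using hrow0 _ (hmem 0)
  have h10 : m 1 0 = 0 := by simpa [e_apply] using hrow1 _ (hmem 1)
  have h00 : m 0 0 = 0 := by simpa [e_apply, h10, hε.ne'] using hrow1 _ (hmem 0)
  have hzero : restrictTo (ballO ε) M = 0 :=
    eq_zero_of_isSupportedAtOrigin hM' (eventually_cutoff_eq_one hε)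
      (by linarith : 3 / 4 * ε < ε) (fun y hy => cutoffProfile_norm_sq_eq_zero hε hy) hk4
      (fun φ => hk ε hε hle φ) h00 h10 h01
  ext φ
  have h1 : M φ = M (TestFunction.monoCLM ℝ (smoothMul φ φ.contDiff (cutoff hε))) := by
    refine hM.congr ?_
    filter_upwards [eventually_cutoff_eq_one hε] with y hy
    rw [coe_monoCLM hle, smoothMul_apply, hy, mul_one]
  rw [h1, ← restrictTo_apply, hzero]
  rfl

end PlanarIncompatibility

end

/-! ### Characterisation of the incompatibility -/

open PlanarIncompatibility in
theorem mainTheorem6 (Ω : Opens PlanarIncompatibility.Plane)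
    (hΩ : IsSimplyConnected (Ω : Set PlanarIncompatibility.Plane))
    (hO : (0 : PlanarIncompatibility.Plane) ∈ Ω)
    (E : Matrix (Fin 2) (Fin 2) 𝓓'(Ω, ℝ)) (hsymm : E.IsSymm)
    (hE : ∀ i j, PlanarIncompatibility.IsSingularField (E i j))
    (E₀ : Matrix (Fin 2) (Fin 2) (PlanarIncompatibility.Plane → ℝ))
    (hE₀ : ∀ i j, PlanarIncompatibility.IsSmoothDensity
      (PlanarIncompatibility.restrictTo (PlanarIncompatibility.puncture Ω) (E i j)) (E₀ i j))
    (N : 𝓓'(Ω, ℝ)) (c : ℕ × ℕ →₀ ℝ)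
    (hN : N = PlanarIncompatibility.pointSupported Ω c)
    (ε : ℝ) (hε : 0 < ε)
    (hball : Metric.closedBall (0 : PlanarIncompatibility.Plane) ε ⊆ Ω) :
    (PlanarIncompatibility.Curl (PlanarIncompatibility.tensorCurl E) = N →
      PlanarIncompatibility.LocalConditions E E₀ N c ε) ∧
    (PlanarIncompatibility.tensorDeg E < 0 →
      (PlanarIncompatibility.Curl (PlanarIncompatibility.tensorCurl E) = N ↔
        PlanarIncompatibility.LocalConditions E E₀ N c ε)) := by
  have hdens : ∀ i j, HasDensityOffOrigin (E i j) (E₀ i j) := fun i j =>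
    (hE₀ i j).hasDensityOffOrigin
  have hcurl : HasDensityOffOrigin (Curl (tensorCurl E)) (curl (fieldCurl E₀)) :=
    HasDensityOffOrigin.curl fun i => HasDensityOffOrigin.curl (hdens i)
  have hNsupp : IsSupportedAtOrigin N := hN ▸ isSupportedAtOrigin_pointSupported Ω c
  have hle : ballO ε ≤ Ω := Metric.ball_subset_closedBall.trans hball
  have hχ : ∀ y, (TestFunction.monoCLM ℝ (cutoff hε) : 𝓓(Ω, ℝ)) y
      = cutoffProfile ε (‖y‖ ^ 2) := fun y => by
    rw [coe_monoCLM hle]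
    rfl
  have hχ1 : ∀ᶠ y in 𝓝 0, (TestFunction.monoCLM ℝ (cutoff hε) : 𝓓(Ω, ℝ)) y = 1 := by
    rw [coe_monoCLM hle]
    exact eventually_cutoff_eq_one hε
  have hnec : Curl (tensorCurl E) = N → LocalConditions E E₀ N c ε := by
    intro h
    have hcc : ∀ y ∈ puncture Ω, curl (fieldCurl E₀) y = 0 := hcurl.eq_zero (h ▸ hNsupp)
    refine ⟨hcc, fun x _ => ?_, h ▸ deg_curl_tensorCurl_le E⟩
    ext i
    rw [← curl_tensorCurl_apply_cutoff hdens hcc hε hball x i hχ hχ1, h, hN,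
      pointSupported_apply_cutoff Ω c x i hχ1]
  refine ⟨hnec, fun hdeg => ⟨hnec, ?_⟩⟩
  rintro ⟨hcc, hces, hdegN⟩
  obtain ⟨k, hk4, hk⟩ := exists_scalesToZero_curl_tensorCurl_sub hdeg hdegN
  have hsupp : IsSupportedAtOrigin (Curl (tensorCurl E) - N) := fun φ hφ => by
    change Curl (tensorCurl E) φ - N φ = 0
    rw [isSupportedAtOrigin_of_density_eq_zero hcurl hcc φ hφ, hNsupp φ hφ, sub_zero]
  refine sub_eq_zero.1 (eq_zero_of_apply_cutoff_eq_zero hsupp hk4 hk hε hball fun x hx i => ?_)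
  change Curl (tensorCurl E) _ - N _ = 0
  rw [curl_tensorCurl_apply_cutoff hdens hcc hε hball x i hχ hχ1, hces x hx, hN,
    pointSupported_apply_cutoff Ω c x i hχ1, sub_self]
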